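/- **Proposition 3.1.** Let $X$ and $Y$ be disjoint $C^2$ submanifolds of $\mathbb{R}^n$, definable (with real parameters) in a polynomially bounded o-minimal expansion of the ordered field of real numbers, with $\dim X=1$ and $0\in X\cap \mathrm{cl}(Y)$. Let $\pi$ be the canonical local retraction onto $X$, which sends a point $y$ near $0$ to its unique nearest point on $X$. For a vector $v$ and linear subspaces $A,B$ of $\mathbb{R}^n$ put $$\eta(v,B)=\sup\{\langle v,u\rangle : u\in B^\perp,\ |u|=1\},\qquad \delta(A,B)=\sup\{\eta(v,B): v\in A,\ |v|=1\},$$ where a supremum over the empty set is $0$ (so $\eta(v,B)$ is the distance from $v$ to $B$), and for $y\in Y$ near $0$ put $$\alpha(y)=\delta\big(T_{\pi(y)}X,\,T_yY\big),\qquad \beta(y)=\eta\Big(\tfrac{y-\pi(y)}{|y-\pi(y)|},\,T_yY\Big).$$ If $(Y,X)$ satisfies Whitney's condition $(b)$ at $0$, that is, $\alpha(y)\to0$ and $\beta(y)\to 0$ as $y\to0$ on $Y$, then $(Y,X)$ satisfies Kuo's ratio test $(r)$ at $0$, that is, $$\frac{|y|\,\alpha(y)}{|y-\pi(y)|}\longrightarrow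 0\quad\text{as } y\to 0 \text{ on } Y.$$ (A structure is o-minimal if every definable subset of $\mathbb{R}$ is a finite union of points and open intervals, and polynomially bounded if for every definable $f:\mathbb{R}\to\mathbb{R}$ there is $N\in\mathbb{N}$ with $|f(t)|\le t^N$ for all sufficiently large $t$.) -/

import Mathlib

open Filter Topology

noncomputable section

/-! ### Polynomially bounded o-minimal structures on the real field

A structure on `ℝ` is a first-order language `L` interpreted in `ℝ`; "definable" means definable by
an `L`-formula with arbitrary real parameters. -/

/-- `L` interpreted in `ℝ` is an o-minimal expansion of the ordered real field. -/
structure IsOMinimalExpansion (L : FirstOrder.Language) [L.Structure ℝ] : Prop where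
  definable_lt : (Set.univ : Set ℝ).Definable L {v : Fin 2 → ℝ | v 0 < v 1}
  definable_add : (Set.univ : Set ℝ).Definable L {v : Fin 3 → ℝ | v 0 + v 1 = v 2}
  definable_mul : (Set.univ : Set ℝ).Definable L {v : Fin 3 → ℝ | v 0 * v 1 = v 2}
  /-- Every definable subset of the line is a finite union of points and open intervals, bounded
  or not. -/
  finite_union : ∀ S : Set ℝ, (Set.univ : Set ℝ).Definable₁ L S →
    ∃ 𝓘 : Set (Set ℝ), 𝓘.Finite ∧
      (∀ J ∈ 𝓘, (∃ a : ℝ, J = {a}) ∨ (∃ a b : EReal, J = {x : ℝ | a < (x : EReal) ∧ (x : EReal) < b})) ∧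
      S = ⋃₀ 𝓘

/-- Every definable function `ℝ → ℝ` is bounded by a power of `t` as `t → +∞`. -/
def IsPolynomiallyBounded (L : FirstOrder.Language) [L.Structure ℝ] : Prop :=
  ∀ f : ℝ → ℝ, (Set.univ : Set ℝ).Definable L {v : Fin 2 → ℝ | v 1 = f (v 0)} →
    ∃ N : ℕ, ∀ᶠ t : ℝ in atTop, |f t| ≤ t ^ N

/-- Definability of a subset of Euclidean space (which is `Fin n → ℝ` with the Euclidean norm). -/
def IsDefinableSet (L : FirstOrder.Language) [L.Structure ℝ] {n : ℕ}
    (S : Set (EuclideanSpace ℝ (Fin n))) : Prop :=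
  (Set.univ : Set ℝ).Definable L {v : Fin n → ℝ | WithLp.toLp 2 v ∈ S}

section Geometry

variable {n : ℕ}

/-! ### Submanifolds of Euclidean space and their tangent spaces -/

/-- `M` is an (embedded) submanifold of `ℝⁿ` of class `C^2` and dimension `d`: around each of its
points some `C^2` diffeomorphism between open subsets of `ℝⁿ` straightens `M` to a
`d`-dimensional linear subspace. -/
def IsC2Submanifold (d : ℕ) (M : Set (EuclideanSpace ℝ (Fin n))) : Prop :=
  ∀ x ∈ M, ∃ (Φ : OpenPartialHomeomorph (EuclideanSpace ℝ (Fin n)) (EuclideanSpace ℝ (Fin n)))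
    (V : Submodule ℝ (EuclideanSpace ℝ (Fin n))),
    x ∈ Φ.source ∧ ContDiffOn ℝ 2 Φ Φ.source ∧ ContDiffOn ℝ 2 Φ.symm Φ.target ∧
    Module.finrank ℝ V = d ∧ ∀ z ∈ Φ.source, (z ∈ M ↔ Φ z ∈ V)

/-- The tangent space `T_x M`, spanned by the velocities at `x` of curves in `M` through `x`
(at a point of a submanifold these velocities already form a linear subspace). -/
def tangentSpaceAt (M : Set (EuclideanSpace ℝ (Fin n))) (x : EuclideanSpace ℝ (Fin n)) :
    Submodule ℝ (EuclideanSpace ℝ (Fin n)) :=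
  Submodule.span ℝ {v | ∃ γ : ℝ → EuclideanSpace ℝ (Fin n),
    γ 0 = x ∧ (∀ᶠ t in 𝓝 (0 : ℝ), γ t ∈ M) ∧ HasDerivAt γ v 0}

/-! ### The canonical retraction and the angles between tangent spaces -/

/-- The canonical retraction `π` onto `X`, sending `y` to its nearest point on `X`. Near any given
point of a `C^2` submanifold `X` this point exists and is unique; the value is only used there. -/
def nearestPoint (X : Set (EuclideanSpace ℝ (Fin n))) (y : EuclideanSpace ℝ (Fin n)) :
    EuclideanSpace ℝ (Fin n) :=
  Classical.epsilon fun x => x ∈ X ∧ ∀ z ∈ X, dist y x ≤ dist y z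

/-- The distance of the vector `v` to the linear subspace `B`,
`η(v, B) = sup { ⟨v, u⟩ : u ∈ Bᗮ, |u| = 1 }` (which is `0` if `B` is the whole space). -/
def distToSubspace (v : EuclideanSpace ℝ (Fin n))
    (B : Submodule ℝ (EuclideanSpace ℝ (Fin n))) : ℝ :=
  sSup {r : ℝ | ∃ u ∈ Bᗮ, ‖u‖ = 1 ∧ r = inner ℝ v u}

/-- `δ(A, B) = sup { η(v, B) : v ∈ A, |v| = 1 }`. -/
def subspaceDelta (A B : Submodule ℝ (EuclideanSpace ℝ (Fin n))) : ℝ :=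
  sSup {r : ℝ | ∃ v ∈ A, ‖v‖ = 1 ∧ r = distToSubspace v B}

/-- `α(y) = δ(T_{π(y)} X, T_y Y)`. -/
def tangentAngle (Y X : Set (EuclideanSpace ℝ (Fin n))) (y : EuclideanSpace ℝ (Fin n)) : ℝ :=
  subspaceDelta (tangentSpaceAt X (nearestPoint X y)) (tangentSpaceAt Y y)

/-- `β(y)`, the distance of the unit vector `(y - π(y)) / |y - π(y)|` to `T_y Y`. -/
def secantAngle (Y X : Set (EuclideanSpace ℝ (Fin n))) (y : EuclideanSpace ℝ (Fin n)) : ℝ :=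
  distToSubspace (‖y - nearestPoint X y‖⁻¹ • (y - nearestPoint X y)) (tangentSpaceAt Y y)

/-! ### Whitney's condition (b) and Kuo's ratio test (r) -/

/-- Whitney's condition (b) for `(Y, X)` at `x₀`: `α(y) → 0` and `β(y) → 0` as `y → x₀` on `Y`. -/
def WhitneyBAt (Y X : Set (EuclideanSpace ℝ (Fin n))) (x₀ : EuclideanSpace ℝ (Fin n)) : Prop :=
  Tendsto (tangentAngle Y X) (𝓝[Y] x₀) (𝓝 0) ∧ Tendsto (secantAngle Y X) (𝓝[Y] x₀) (𝓝 0)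

/-- Kuo's ratio test (r) for `(Y, X)` at `x₀`:
`|y - x₀| α(y) / |y - π(y)| → 0` as `y → x₀` on `Y`. -/
def KuoRatioTestAt (Y X : Set (EuclideanSpace ℝ (Fin n))) (x₀ : EuclideanSpace ℝ (Fin n)) : Prop :=
  Tendsto (fun y => ‖y - x₀‖ * tangentAngle Y X y / ‖y - nearestPoint X y‖) (𝓝[Y] x₀) (𝓝 0)

end Geometry

end

/-
If the ratio test fails, definable choice gives definable curves `y(t)` on `Y` and `x(t) = π(y(t))`
on `X`, for small `t > 0`, with `|y - x₀| = t` and `ε |y - x| < t α(y)`. Since `α(y) → 0`, the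
difference `z = y - x` is `o(t)`. Write `z = ρ U` with `ρ = |z|`. Definable functions of one
variable are eventually monotone and differentiable, and polynomial boundedness gives
`t ρ' = O(ρ)` and `t U' → 0`. Hence `t z' = (t ρ') U + ρ (t U')` is `O(ρ) = o(t)`, so `z' → 0`.
Moreover `η(t z', T_y Y) = o(ρ)`, because `η(U, T_y Y) → 0` by condition (b). Now `x' = y' - z'`,
where `y' ∈ T_y Y` and `|y'| ≥ 1`, so eventually `|x'| ≥ 1/2`, and as `x'` spans `T_x X`,
`t α(y) ≤ 2 t |x'| α(y) = 2 η(t x', T_y Y) = 2 η(t z', T_y Y) = o(ρ)`, contrary to `ε ρ < t α(y)`.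
-/

/-- A type identified with a finite power of `ℝ`, so that definability of predicates on it and of
maps into and out of it makes sense. -/
class RealCoordinates (E : Type) where
  /-- The index set of the coordinates. -/
  index : Type
  finite_index : Finite index
  /-- The tuple of coordinates of a point. -/
  coords : E ≃ (index → ℝ)

namespace RealCoordinates

attribute [instance] finite_index

instance : RealCoordinates ℝ := ⟨Unit, inferInstance, (Equiv.funUnique Unit ℝ).symm⟩

instance (n : ℕ) : RealCoordinates (Fin n → ℝ) := ⟨Fin n, inferInstance, Equiv.refl _⟩

instance (n : ℕ) : RealCoordinates (EuclideanSpace ℝ (Fin n)) :=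
  ⟨Fin n, inferInstance, WithLp.equiv 2 _⟩

instance (E F : Type) [RealCoordinates E] [RealCoordinates F] : RealCoordinates (E × F) :=
  ⟨index E ⊕ index F, inferInstance,
    (Equiv.prodCongr coords coords).trans (Equiv.sumArrowEquivProdArrow _ _ _).symm⟩

end RealCoordinates

open RealCoordinates

section Definability

variable {L : FirstOrder.Language} [L.Structure ℝ]
variable {E F G : Type} [RealCoordinates E] [RealCoordinates F] [RealCoordinates G]

variable (L) in
/-- A predicate is definable (with real parameters) if it is so in coordinates. -/
@[fun_prop]
def DefinablePred (P : E → Prop) : Prop :=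
  (Set.univ : Set ℝ).Definable L {v : index E → ℝ | P (coords.symm v)}

variable (L) in
/-- A map is definable (with real parameters) if it is so in coordinates. -/
@[fun_prop]
def DefinableMap (f : E → F) : Prop :=
  (Set.univ : Set ℝ).DefinableMap L fun v : index E → ℝ => coords (f (coords.symm v))

theorem DefinableMap.coord (i : index E) : DefinableMap L fun p : E => coords p i := by
  intro _
  simpa using! Set.DefinableFun.proj L

theorem DefinableMap.of_coords {f : E → F} (h : ∀ i, DefinableMap L fun p => coords (f p) i) :
    DefinableMap L f :=
  fun i => h i ()

@[fun_prop]
theorem DefinableMap.id : DefinableMap L fun p : E => p :=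
  of_coords coord

@[fun_prop]
theorem DefinableMap.const (c : F) : DefinableMap L fun _ : E => c :=
  fun _ => L.definableFun_const _ (Set.mem_univ _)

@[fun_prop]
theorem DefinableMap.comp {g : F → G} {f : E → F} (hg : DefinableMap L g)
    (hf : DefinableMap L f) : DefinableMap L fun p => g (f p) := fun i => by
  simpa using! Set.DefinableFun.comp hf (hg i)

@[fun_prop]
theorem DefinableMap.prodMk {f : E → F} {g : E → G} (hf : DefinableMap L f)
    (hg : DefinableMap L g) : DefinableMap L fun p => (f p, g p) :=
  Sum.rec hf hg

@[fun_prop]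
theorem DefinableMap.fst {f : E → F × G} (hf : DefinableMap L f) :
    DefinableMap L fun p => (f p).1 :=
  fun i => hf (Sum.inl i)

@[fun_prop]
theorem DefinableMap.snd {f : E → F × G} (hf : DefinableMap L f) :
    DefinableMap L fun p => (f p).2 :=
  fun i => hf (Sum.inr i)

namespace DefinablePred

variable {P Q : E → Prop}

theorem congr (hP : DefinablePred L P) (h : ∀ p, Q p ↔ P p) : DefinablePred L Q :=
  (funext fun p => propext (h p) : Q = P) ▸ hP

@[fun_prop]
theorem and (hP : DefinablePred L P) (hQ : DefinablePred L Q) :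
    DefinablePred L fun p => P p ∧ Q p :=
  Set.Definable.inter hP hQ

@[fun_prop]
theorem or (hP : DefinablePred L P) (hQ : DefinablePred L Q) :
    DefinablePred L fun p => P p ∨ Q p :=
  Set.Definable.union hP hQ

@[fun_prop]
theorem not (hP : DefinablePred L P) : DefinablePred L fun p => ¬P p :=
  Set.Definable.compl hP

theorem imp (hP : DefinablePred L P) (hQ : DefinablePred L Q) :
    DefinablePred L fun p => P p → Q p :=
  (hP.not.or hQ).congr fun _ => imp_iff_not_or

@[fun_prop]
theorem comp {P : F → Prop} {f : E → F} (hP : DefinablePred L P) (hf : DefinableMap L f) :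
    DefinablePred L fun p => P (f p) := by
  simpa [DefinablePred, Set.preimage] using! Set.Definable.preimage_map hf hP

theorem comp₂ {P : F → G → Prop} {f : E → F} {g : E → G}
    (hP : DefinablePred L fun q : F × G => P q.1 q.2) (hf : DefinableMap L f)
    (hg : DefinableMap L g) : DefinablePred L fun p => P (f p) (g p) :=
  hP.comp (hf.prodMk hg)

@[fun_prop]
theorem eq {f g : E → F} (hf : DefinableMap L f) (hg : DefinableMap L g) :
    DefinablePred L fun p => f p = g p := by
  refine (?_ : DefinablePred L fun p => ∀ i, coords (f p) i = coords (g p) i).congr fun p => by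
    rw [← coords.injective.eq_iff, funext_iff]
  simpa [DefinablePred, Set.ofPred_forall] using!
    Set.definable_iInter_of_finite fun i => (hf i).ofPred_eq (hg i)

end DefinablePred

@[fun_prop]
theorem DefinablePred.exists {P : E → F → Prop} (hP : DefinablePred L fun q : E × F => P q.1 q.2) :
    DefinablePred L fun p => ∃ x, P p x := by
  refine (?_ : DefinablePred L fun p : E => ∃ u, P p (coords.symm u)).congr fun _ =>
    coords.symm.surjective.exists
  exact Set.Definable.exists_of_finite (α := index E) (β := index F) hP

theorem DefinablePred.forall {P : E → F → Prop}
    (hP : DefinablePred L fun q : E × F => P q.1 q.2) :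
    DefinablePred L fun p => ∀ x, P p x :=
  hP.not.exists.not.congr fun _ => not_exists_not.symm

theorem DefinableMap.of_graph {f : E → ℝ} (hf : DefinablePred L fun p : E × ℝ => f p.1 = p.2) :
    DefinableMap L f := fun _ => by
  simpa [Set.DefinableFun, Function.tupleGraph] using!
    Set.Definable.preimage_comp (Sum.elim some fun _ => none : index E ⊕ Unit → Option (index E)) hf

@[fun_prop]
theorem DefinableMap.euclidean_apply {n : ℕ} {f : E → EuclideanSpace ℝ (Fin n)}
    (hf : DefinableMap L f) (i : Fin n) : DefinableMap L fun p => f p i :=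
  (coord (E := EuclideanSpace ℝ (Fin n)) i).comp hf

theorem DefinableMap.ite {P : E → Prop} [DecidablePred P] {f g : E → F}
    (hP : DefinablePred L P) (hf : DefinableMap L f) (hg : DefinableMap L g) :
    DefinableMap L fun p => if P p then f p else g p := fun i => by
  simpa only [apply_ite coords, ite_apply] using Set.DefinableFun.ite hP (hf i) (hg i)

section Field

variable (hL : IsOMinimalExpansion L) {f g : E → ℝ}
include hL

@[fun_prop]
theorem DefinablePred.lt (hf : DefinableMap L f) (hg : DefinableMap L g) :
    DefinablePred L fun p => f p < g p :=
  DefinablePred.comp (P := fun v : Fin 2 → ℝ => v 0 < v 1) hL.definable_lt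
    (.of_coords (f := fun p => ![f p, g p]) (Fin.forall_fin_two.2 ⟨hf, hg⟩))

@[fun_prop]
theorem DefinablePred.le (hf : DefinableMap L f) (hg : DefinableMap L g) :
    DefinablePred L fun p => f p ≤ g p :=
  (DefinablePred.lt hL hg hf).not.congr fun _ => not_lt.symm

namespace DefinableMap

@[fun_prop]
theorem add (hf : DefinableMap L f) (hg : DefinableMap L g) :
    DefinableMap L fun p => f p + g p :=
  .of_graph <| DefinablePred.comp (P := fun v : Fin 3 → ℝ => v 0 + v 1 = v 2) hL.definable_add
    (.of_coords (f := fun p : E × ℝ => ![f p.1, g p.1, p.2])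
      (Fin.forall_fin_succ.2
        ⟨hf.comp (.fst .id), Fin.forall_fin_two.2 ⟨hg.comp (.fst .id), .snd .id⟩⟩))

@[fun_prop]
theorem mul (hf : DefinableMap L f) (hg : DefinableMap L g) :
    DefinableMap L fun p => f p * g p :=
  .of_graph <| DefinablePred.comp (P := fun v : Fin 3 → ℝ => v 0 * v 1 = v 2) hL.definable_mul
    (.of_coords (f := fun p : E × ℝ => ![f p.1, g p.1, p.2])
      (Fin.forall_fin_succ.2
        ⟨hf.comp (.fst .id), Fin.forall_fin_two.2 ⟨hg.comp (.fst .id), .snd .id⟩⟩))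

@[fun_prop]
theorem neg (hf : DefinableMap L f) : DefinableMap L fun p => -f p := by
  simpa using (const (-1)).mul hL hf

@[fun_prop]
theorem sub (hf : DefinableMap L f) (hg : DefinableMap L g) :
    DefinableMap L fun p => f p - g p := by
  simpa only [sub_eq_add_neg] using hf.add hL (hg.neg hL)

@[fun_prop]
theorem inv (hf : DefinableMap L f) : DefinableMap L fun p => (f p)⁻¹ := by
  refine .of_graph ((?_ : DefinablePred L fun p : E × ℝ =>
    f p.1 * p.2 = 1 ∨ f p.1 = 0 ∧ p.2 = 0).congr fun p => ?_)
  · fun_prop (disch := assumption)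
  · grind

@[fun_prop]
theorem div (hf : DefinableMap L f) (hg : DefinableMap L g) :
    DefinableMap L fun p => f p / g p := by
  simpa only [div_eq_mul_inv] using hf.mul hL (hg.inv hL)

@[fun_prop]
theorem pow (hf : DefinableMap L f) (N : ℕ) : DefinableMap L fun p => f p ^ N := by
  induction N with
  | zero => simpa only [pow_zero] using const (1 : ℝ)
  | succ N ih => simpa only [pow_succ] using ih.mul hL hf

theorem sum {ι : Type} (s : Finset ι) {f : ι → E → ℝ} (hf : ∀ i, DefinableMap L (f i)) :
    DefinableMap L fun p => ∑ i ∈ s, f i p := by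
  classical
  induction s using Finset.induction_on with
  | empty => simpa using const (0 : ℝ)
  | insert i s hi ih => simpa only [Finset.sum_insert hi] using (hf i).add hL ih

variable {n : ℕ} {u v : E → EuclideanSpace ℝ (Fin n)}

@[fun_prop]
theorem euclidean_sub (hu : DefinableMap L u) (hv : DefinableMap L v) :
    DefinableMap L fun p => u p - v p :=
  of_coords fun i => (hu.euclidean_apply i).sub hL (hv.euclidean_apply i)

@[fun_prop]
theorem euclidean_smul (hf : DefinableMap L f) (hu : DefinableMap L u) :
    DefinableMap L fun p => f p • u p :=
  of_coords fun i => hf.mul hL (hu.euclidean_apply i)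

@[fun_prop]
protected theorem inner (hu : DefinableMap L u) (hv : DefinableMap L v) :
    DefinableMap L fun p => inner ℝ (u p) (v p) := by
  simp only [PiLp.inner_apply, RCLike.inner_apply, conj_trivial]
  exact sum hL _ fun i => by fun_prop (disch := assumption)

@[fun_prop]
protected theorem norm (hu : DefinableMap L u) : DefinableMap L fun p => ‖u p‖ := by
  refine .of_graph ((?_ : DefinablePred L fun p : E × ℝ =>
    0 ≤ p.2 ∧ p.2 ^ 2 = inner ℝ (u p.1) (u p.1)).congr fun p => ?_)
  · fun_prop (disch := assumption)
  · rw [real_inner_self_eq_norm_sq]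
    exact ⟨fun h => h ▸ ⟨norm_nonneg _, rfl⟩,
      fun h => ((sq_eq_sq₀ h.1 (norm_nonneg _)).1 h.2).symm⟩

@[fun_prop]
protected theorem abs (hf : DefinableMap L f) : DefinableMap L fun p => |f p| := by
  refine .of_graph ((?_ : DefinablePred L fun p : E × ℝ =>
    0 ≤ p.2 ∧ p.2 ^ 2 = f p.1 ^ 2).congr fun p => ?_)
  · fun_prop (disch := assumption)
  · rw [← sq_abs (f p.1)]
    exact ⟨fun h => h ▸ ⟨abs_nonneg _, rfl⟩,
      fun h => ((sq_eq_sq₀ h.1 (abs_nonneg _)).1 h.2).symm⟩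

theorem dist_real : DefinableMap L fun p : ℝ × ℝ => dist p.1 p.2 := by
  simp only [Real.dist_eq]
  fun_prop (disch := assumption)

theorem dist_euclidean :
    DefinableMap L fun p : EuclideanSpace ℝ (Fin n) × EuclideanSpace ℝ (Fin n) =>
      dist p.1 p.2 := by
  simp only [dist_eq_norm]
  fun_prop (disch := assumption)

end DefinableMap

theorem DefinablePred.eventually_nhds [PseudoMetricSpace F]
    (hdist : DefinableMap L fun p : F × F => dist p.1 p.2) {P : E → F → Prop} {f : E → F}
    (hP : DefinablePred L fun q : E × F => P q.1 q.2) (hf : DefinableMap L f) :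
    DefinablePred L fun p => ∀ᶠ y in 𝓝 (f p), P p y := by
  refine (?_ : DefinablePred L fun p => ∃ r : ℝ, 0 < r ∧ ∀ y, dist y (f p) < r → P p y).congr
    fun p => Metric.eventually_nhds_iff
  refine .exists (.and (by fun_prop (disch := assumption)) (.forall (.imp ?_ ?_)))
  · exact .lt hL (hdist.comp (f := fun q : (E × ℝ) × F => (q.2, f q.1.1)) (by fun_prop))
      (by fun_prop)
  · exact hP.comp (f := fun q : (E × ℝ) × F => (q.1.1, q.2)) (by fun_prop)

theorem DefinablePred.eventually_nhdsWithin [PseudoMetricSpace F]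
    (hdist : DefinableMap L fun p : F × F => dist p.1 p.2) {P : E → F → Prop} {f : E → F}
    {s : E → Set F} (hs : DefinablePred L fun q : E × F => q.2 ∈ s q.1)
    (hP : DefinablePred L fun q : E × F => P q.1 q.2) (hf : DefinableMap L f) :
    DefinablePred L fun p => ∀ᶠ y in 𝓝[s p] (f p), P p y :=
  (eventually_nhds hL hdist (hs.imp hP) hf).congr fun _ => eventually_nhdsWithin_iff

end Field

end Definability

section OrderTopology

variable {α β : Type*} [LinearOrder α] [TopologicalSpace α] [OrderTopology α]

theorem eventually_nhdsGT_mem_or_notMem {s : Set α} (hs : s.OrdConnected) (a : α) :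
    (∀ᶠ x in 𝓝[>] a, x ∈ s) ∨ ∀ᶠ x in 𝓝[>] a, x ∉ s := by
  refine or_iff_not_imp_right.2 fun h => ?_
  replace h : ∃ᶠ x in 𝓝[>] a, x ∈ s := by simpa using h
  obtain ⟨b, hb, hab⟩ := (h.and_eventually self_mem_nhdsWithin).exists
  filter_upwards [Ioo_mem_nhdsGT hab] with y hy
  obtain ⟨c, hc, hac⟩ := (h.and_eventually (Ioo_mem_nhdsGT hy.1)).exists
  exact hs.out hc hb ⟨hac.2.le, hy.2.le⟩

theorem eventually_nhdsLT_mem_or_notMem {s : Set α} (hs : s.OrdConnected) (a : α) :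
    (∀ᶠ x in 𝓝[<] a, x ∈ s) ∨ ∀ᶠ x in 𝓝[<] a, x ∉ s :=
  eventually_nhdsGT_mem_or_notMem (α := αᵒᵈ) hs.dual (OrderDual.toDual a)

end OrderTopology

section LocallyMonotone

variable {β : Type*} [Preorder β] {f : ℝ → β} {a b : ℝ}

theorem monotoneOn_Ioo_of_eventually_le
    (hr : ∀ x ∈ Set.Ioo a b, ∀ᶠ y in 𝓝[>] x, f x ≤ f y)
    (hl : ∀ x ∈ Set.Ioo a b, ∀ᶠ y in 𝓝[<] x, f y ≤ f x) : MonotoneOn f (Set.Ioo a b) := by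
  intro x hx y hy hxy
  let S : Set ℝ := {s | s ∈ Set.Icc x y ∧ ∀ r ∈ Set.Icc x s, f x ≤ f r}
  have hxS : x ∈ S := ⟨⟨le_rfl, hxy⟩, fun r hr => by rw [le_antisymm hr.1 hr.2]⟩
  obtain ⟨c, hc⟩ : ∃ c, IsLUB S c := Real.exists_isLUB ⟨x, hxS⟩ ⟨y, fun s hs => hs.1.2⟩
  have hxc : x ≤ c := hc.1 hxS
  have hcy : c ≤ y := hc.2 fun s hs => hs.1.2
  have hcI : c ∈ Set.Ioo a b := ⟨hx.1.trans_le hxc, hcy.trans_lt hy.2⟩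
  have hlt : ∀ r, x ≤ r → r < c → f x ≤ f r := fun r hxr hrc => by
    obtain ⟨s, hs, hrs⟩ := (lt_isLUB_iff hc).1 hrc
    exact hs.2 r ⟨hxr, hrs.le⟩
  have hfc : f x ≤ f c := by
    rcases hxc.eq_or_lt with rfl | h
    · exact le_rfl
    · obtain ⟨r, hr, hxr⟩ := ((hl c hcI).and (Ioo_mem_nhdsLT h)).exists
      exact (hlt r hxr.1.le hxr.2).trans hr
  rcases hcy.eq_or_lt with rfl | h
  · exact hfc
  obtain ⟨e, hce, heI⟩ := mem_nhdsGT_iff_exists_Ioo_subset.1 (hr c hcI)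
  obtain ⟨d, hcd, hd⟩ := exists_between (lt_min hce h)
  have hdS : d ∈ S := by
    refine ⟨⟨hxc.trans hcd.le, (lt_min_iff.1 hd).2.le⟩, fun r hr => ?_⟩
    rcases lt_trichotomy r c with h' | rfl | h'
    · exact hlt r hr.1 h'
    · exact hfc
    · exact hfc.trans (heI ⟨h', hr.2.trans_lt (lt_min_iff.1 hd).1⟩)
  exact absurd (hc.1 hdS) hcd.not_ge

theorem exists_monotoneOn_Ioo (hr : ∀ᶠ x in 𝓝[>] a, ∀ᶠ y in 𝓝[>] x, f x ≤ f y)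
    (hl : ∀ᶠ x in 𝓝[>] a, ∀ᶠ y in 𝓝[<] x, f y ≤ f x) :
    ∃ b > a, MonotoneOn f (Set.Ioo a b) := by
  obtain ⟨b, hab, hb⟩ := mem_nhdsGT_iff_exists_Ioo_subset.1 (hr.and hl)
  exact ⟨b, hab, monotoneOn_Ioo_of_eventually_le (fun x hx => (hb hx).1) fun x hx => (hb hx).2⟩

theorem exists_antitoneOn_Ioo (hr : ∀ᶠ x in 𝓝[>] a, ∀ᶠ y in 𝓝[>] x, f y ≤ f x)
    (hl : ∀ᶠ x in 𝓝[>] a, ∀ᶠ y in 𝓝[<] x, f x ≤ f y) :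
    ∃ b > a, AntitoneOn f (Set.Ioo a b) :=
  exists_monotoneOn_Ioo (β := βᵒᵈ) hr hl

theorem countable_setOf_strict_localMin {α : Type*} [TopologicalSpace α]
    [SecondCountableTopology α] (f : α → β) : {x | ∀ᶠ y in 𝓝[≠] x, f x < f y}.Countable := by
  have h : ∀ x, (∀ᶠ y in 𝓝[≠] x, f x < f y) →
      ∃ U ∈ TopologicalSpace.countableBasis α, x ∈ U ∧ ∀ y ∈ U, y ≠ x → f x < f y := fun x hx =>
    (TopologicalSpace.isBasis_countableBasis α).mem_nhds_iff.1 (eventually_nhdsWithin_iff.1 hx)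
  choose! U hU hxU hlt using h
  refine Set.MapsTo.countable_of_injOn (f := U) hU (fun x hx y hy hxy => ?_)
    (TopologicalSpace.countable_countableBasis α)
  by_contra hne
  exact lt_asymm (hlt x hx y (hxy ▸ hxU y hy) (Ne.symm hne)) (hlt y hy x (hxy ▸ hxU x hx) hne)

theorem not_eventually_strict_localMin :
    ¬∀ᶠ x in 𝓝[>] a, ∀ᶠ y in 𝓝[≠] x, f x < f y := fun h => by
  obtain ⟨b, hab, hb⟩ := mem_nhdsGT_iff_exists_Ioo_subset.1 h
  exact (Set.mem_Ioi.1 hab).not_ge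
    (Cardinal.Real.Ioo_countable_iff.1 ((countable_setOf_strict_localMin f).mono hb))

end LocallyMonotone

section OneVariable

variable {L : FirstOrder.Language} [L.Structure ℝ]

variable (L) in
/-- Along the filter `l`, every definable predicate either eventually holds or eventually fails;
germs along `l` of definable functions are thus totally ordered. -/
def DecidesDefinable {E : Type} [RealCoordinates E] (l : Filter E) : Prop :=
  ∀ ⦃P : E → Prop⦄, DefinablePred L P → (∀ᶠ x in l, P x) ∨ ∀ᶠ x in l, ¬P x

namespace DecidesDefinable

variable {E : Type} [RealCoordinates E] {l : Filter E} (hl : DecidesDefinable L l)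
include hl

theorem eventually_or {P Q : E → Prop} (hP : DefinablePred L P) (h : ∀ᶠ x in l, P x ∨ Q x) :
    (∀ᶠ x in l, P x) ∨ ∀ᶠ x in l, Q x :=
  (hl hP).imp_right fun h' => (h.and h').mono fun _ hx => hx.1.resolve_left hx.2

theorem eventually_of_frequently {P : E → Prop} (hP : DefinablePred L P) (h : ∃ᶠ x in l, P x) :
    ∀ᶠ x in l, P x :=
  (hl hP).resolve_right h

theorem eventually_le_or_le (hL : IsOMinimalExpansion L) {f g : E → ℝ} (hf : DefinableMap L f)
    (hg : DefinableMap L g) : (∀ᶠ x in l, f x ≤ g x) ∨ ∀ᶠ x in l, g x ≤ f x :=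
  hl.eventually_or (.le hL hf hg) (.of_forall fun x => le_total (f x) (g x))

theorem eventually_pos_or_eq_zero_or_neg (hL : IsOMinimalExpansion L) {f : E → ℝ}
    (hf : DefinableMap L f) :
    (∀ᶠ x in l, 0 < f x) ∨ (∀ᶠ x in l, f x = 0) ∨ ∀ᶠ x in l, f x < 0 := by
  rcases hl (.lt hL (.const 0) hf) with h | h
  · exact .inl h
  · exact .inr (hl.eventually_or (.eq hf (.const 0))
      (h.mono fun x hx => (not_lt.1 hx).eq_or_lt))

end DecidesDefinable

namespace IsOMinimalExpansion

variable (hL : IsOMinimalExpansion L)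
include hL

theorem decidesDefinable {l : Filter ℝ}
    (hl : ∀ J : Set ℝ, J.OrdConnected → (∀ᶠ x in l, x ∈ J) ∨ ∀ᶠ x in l, x ∉ J) :
    DecidesDefinable L l := by
  intro P hP
  obtain ⟨𝓘, hfin, h𝓘, hS⟩ := hL.finite_union {x | P x}
    (hP.comp (.coord (E := Fin 1 → ℝ) (0 : Fin 1)))
  have hmem : ∀ x, P x ↔ ∃ J ∈ 𝓘, x ∈ J := fun x => by
    rw [← Set.mem_sUnion, ← hS, Set.mem_ofPred_eq]
  have hord : ∀ J ∈ 𝓘, J.OrdConnected := fun J hJ => by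
    rcases h𝓘 J hJ with ⟨a, rfl⟩ | ⟨a, b, rfl⟩
    · exact Set.ordConnected_singleton
    · exact Set.ordConnected_Ioo.preimage_mono fun _ _ => EReal.coe_le_coe
  by_cases h : ∃ J ∈ 𝓘, ∀ᶠ x in l, x ∈ J
  · obtain ⟨J, hJ, h⟩ := h
    exact .inl (h.mono fun x hx => (hmem x).2 ⟨J, hJ, hx⟩)
  · simp only [not_exists, not_and] at h
    have hnone := (eventually_all_finite hfin).2 fun J hJ =>
      (hl J (hord J hJ)).resolve_left (h J hJ)
    exact .inr (hnone.mono fun x hx => by simpa [hmem] using hx)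

theorem decidesDefinable_nhdsGT (a : ℝ) : DecidesDefinable L (𝓝[>] a) :=
  hL.decidesDefinable fun _ hJ => eventually_nhdsGT_mem_or_notMem hJ a

theorem decidesDefinable_nhdsLT (a : ℝ) : DecidesDefinable L (𝓝[<] a) :=
  hL.decidesDefinable fun _ hJ => eventually_nhdsLT_mem_or_notMem hJ a

variable {f : ℝ → ℝ}

theorem exists_monotoneOn_or_antitoneOn_of_localMin (hf : DefinableMap L f) {a : ℝ}
    (hr : ∀ᶠ x in 𝓝[>] a, ∀ᶠ y in 𝓝[>] x, f x ≤ f y)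
    (hl : ∀ᶠ x in 𝓝[>] a, ∀ᶠ y in 𝓝[<] x, f x ≤ f y) :
    ∃ b > a, MonotoneOn f (Set.Ioo a b) ∨ AntitoneOn f (Set.Ioo a b) := by
  have hstrict : DefinablePred L fun x => ∀ᶠ y in 𝓝[≠] x, f x < f y :=
    .eventually_nhdsWithin hL (.dist_real hL) (.not (.eq (.snd .id) (.fst .id)))
      (by fun_prop (disch := assumption)) .id
  have hnot : ∀ᶠ x in 𝓝[>] a, ¬∀ᶠ y in 𝓝[≠] x, f x < f y :=
    (hL.decidesDefinable_nhdsGT a hstrict).resolve_left not_eventually_strict_localMin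
  have hside : ∀ᶠ x in 𝓝[>] a, (∀ᶠ y in 𝓝[>] x, f y ≤ f x) ∨ ∀ᶠ y in 𝓝[<] x, f y ≤ f x := by
    filter_upwards [hnot] with x hx
    have hdef : DefinablePred L fun y => f y ≤ f x := by fun_prop (disch := assumption)
    by_contra h
    rw [not_or] at h
    refine hx ?_
    rw [← nhdsLT_sup_nhdsGT, eventually_sup]
    simpa only [not_le] using And.intro ((hL.decidesDefinable_nhdsLT x hdef).resolve_left h.2)
      ((hL.decidesDefinable_nhdsGT x hdef).resolve_left h.1)
  have hright : DefinablePred L fun x => ∀ᶠ y in 𝓝[>] x, f y ≤ f x :=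
    .eventually_nhdsWithin hL (.dist_real hL)
      (by simp only [Set.mem_Ioi]; fun_prop (disch := assumption))
      (by fun_prop (disch := assumption)) .id
  rcases (hL.decidesDefinable_nhdsGT a).eventually_or hright hside with h | h
  · exact (exists_antitoneOn_Ioo h hl).imp fun _ hb => hb.imp_right .inr
  · exact (exists_monotoneOn_Ioo hr h).imp fun _ hb => hb.imp_right .inl

theorem exists_monotoneOn_or_antitoneOn (hf : DefinableMap L f) (a : ℝ) :
    ∃ b > a, MonotoneOn f (Set.Ioo a b) ∨ AntitoneOn f (Set.Ioo a b) := by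
  have hgt : ∀ {P : ℝ → ℝ → Prop}, (DefinablePred L fun q : ℝ × ℝ => P q.1 q.2) →
      DefinablePred L fun x => ∀ᶠ y in 𝓝[>] x, P x y := fun hP =>
    .eventually_nhdsWithin hL (.dist_real hL)
      (by simp only [Set.mem_Ioi]; fun_prop (disch := assumption)) hP .id
  have hlt : ∀ {P : ℝ → ℝ → Prop}, (DefinablePred L fun q : ℝ × ℝ => P q.1 q.2) →
      DefinablePred L fun x => ∀ᶠ y in 𝓝[<] x, P x y := fun hP =>
    .eventually_nhdsWithin hL (.dist_real hL)
      (by simp only [Set.mem_Iio]; fun_prop (disch := assumption)) hP .id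
  have hle : DefinablePred L fun q : ℝ × ℝ => f q.1 ≤ f q.2 := by fun_prop (disch := assumption)
  have hr := (hL.decidesDefinable_nhdsGT a).eventually_or (hgt hle) (.of_forall fun x =>
    (hL.decidesDefinable_nhdsGT x).eventually_le_or_le hL (.const (f x)) hf)
  have hl := (hL.decidesDefinable_nhdsGT a).eventually_or (hlt hle) (.of_forall fun x =>
    (hL.decidesDefinable_nhdsLT x).eventually_le_or_le hL (.const (f x)) hf)
  rcases hr with hr | hr <;> rcases hl with hl | hl
  · exact hL.exists_monotoneOn_or_antitoneOn_of_localMin hf hr hl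
  · exact (exists_monotoneOn_Ioo hr hl).imp fun _ hb => hb.imp_right .inl
  · exact (exists_antitoneOn_Ioo hr hl).imp fun _ hb => hb.imp_right .inr
  · obtain ⟨b, hab, hb⟩ := hL.exists_monotoneOn_or_antitoneOn_of_localMin (f := fun x => -f x)
      (hf.neg hL) (by simpa only [neg_le_neg_iff] using hr)
      (by simpa only [neg_le_neg_iff] using hl)
    exact ⟨b, hab, hb.symm.imp (fun h => by simpa using h.neg) fun h => by simpa using h.neg⟩

theorem exists_tendsto_nhdsGT (hf : DefinableMap L f) {a C : ℝ}
    (hC : ∀ᶠ x in 𝓝[>] a, |f x| ≤ C) : ∃ l, Tendsto f (𝓝[>] a) (𝓝 l) := by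
  obtain ⟨b, hab, hmono⟩ := hL.exists_monotoneOn_or_antitoneOn hf a
  obtain ⟨c, hac, hc⟩ := mem_nhdsGT_iff_exists_Ioo_subset.1 hC
  have hac : a < c := hac
  have hlt : a < min b c := lt_min hab hac
  have hsub : Set.Ioo a (min b c) ⊆ Set.Ioo a b := Set.Ioo_subset_Ioo_right (min_le_left _ _)
  have hbd : ∀ x ∈ Set.Ioo a (min b c), |f x| ≤ C := fun x hx =>
    hc ⟨hx.1, hx.2.trans_le (min_le_right _ _)⟩
  rcases hmono with h | h
  · exact ⟨_, (h.mono hsub).tendsto_nhdsWithin_Ioo_right (Set.nonempty_Ioo.2 hlt)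
      ⟨-C, Set.forall_mem_image.2 fun x hx => (abs_le.1 (hbd x hx)).1⟩⟩
  · exact ⟨_, (h.mono hsub).tendsto_nhdsWithin_Ioo_right (Set.nonempty_Ioo.2 hlt)
      ⟨C, Set.forall_mem_image.2 fun x hx => (abs_le.1 (hbd x hx)).2⟩⟩

theorem definablePred_differentiableAt (hf : DefinableMap L f) :
    DefinablePred L fun x => DifferentiableAt ℝ f x := by
  refine (?_ : DefinablePred L fun x => ∃ f' : ℝ, ∀ c : ℝ, 0 < c →
    ∀ᶠ y in 𝓝 x, |f y - f x - (y - x) * f'| ≤ c * |y - x|).congr fun x => ?_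
  · refine .exists (.forall (.imp (by fun_prop (disch := assumption)) ?_))
    exact .eventually_nhds hL (.dist_real hL) (f := fun q : (ℝ × ℝ) × ℝ => q.1.1)
      (by fun_prop (disch := assumption)) (by fun_prop)
  · refine ⟨fun h => ⟨deriv f x, ?_⟩, fun ⟨f', h⟩ => HasDerivAt.differentiableAt (f' := f') ?_⟩
    · simpa [Asymptotics.isLittleO_iff] using hasDerivAt_iff_isLittleO.1 h.hasDerivAt
    · simpa [hasDerivAt_iff_isLittleO, Asymptotics.isLittleO_iff] using h

theorem eventually_differentiableAt (hf : DefinableMap L f) (a : ℝ) :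
    ∀ᶠ x in 𝓝[>] a, DifferentiableAt ℝ f x := by
  obtain ⟨b, hab, hmono⟩ := hL.exists_monotoneOn_or_antitoneOn hf a
  have hae : ∀ᵐ x, x ∈ Set.Ioo a b → DifferentiableWithinAt ℝ f (Set.Ioo a b) x := by
    rcases hmono with h | h
    · exact h.ae_differentiableWithinAt_of_mem
    · filter_upwards [h.neg.ae_differentiableWithinAt_of_mem] with x hx hxI
      simpa using (hx hxI).neg
  refine (hL.decidesDefinable_nhdsGT a).eventually_of_frequently
    (hL.definablePred_differentiableAt hf) (frequently_iff.2 fun hU => ?_)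
  obtain ⟨c, hac, hc⟩ := mem_nhdsGT_iff_exists_Ioo_subset.1 hU
  obtain ⟨x, hxI, hx⟩ := (MeasureTheory.Measure.dense_of_ae hae).inter_open_nonempty
    (Set.Ioo a (min b c)) isOpen_Ioo (Set.nonempty_Ioo.2 (lt_min hab hac))
  obtain ⟨hxb, hxc⟩ := lt_min_iff.1 hxI.2
  exact ⟨x, hc ⟨hxI.1, hxc⟩, (hx ⟨hxI.1, hxb⟩).differentiableAt (Ioo_mem_nhds hxI.1 hxb)⟩

end IsOMinimalExpansion

end OneVariable

theorem eventually_nhdsGT_eventually_nhds {α : Type*} [LinearOrder α] [TopologicalSpace α]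
    [ClosedIicTopology α] {a : α} {P : α → Prop} (h : ∀ᶠ x in 𝓝[>] a, P x) :
    ∀ᶠ x in 𝓝[>] a, ∀ᶠ y in 𝓝 x, P y := by
  filter_upwards [eventually_eventually_nhdsWithin.2 h, self_mem_nhdsWithin] with x hx hax
  rwa [isOpen_Ioi.nhdsWithin_eq hax] at hx

section PolynomiallyBounded

variable {L : FirstOrder.Language} [L.Structure ℝ]

namespace IsOMinimalExpansion

variable (hL : IsOMinimalExpansion L) {f : ℝ → ℝ} (hf : DefinableMap L f) {a : ℝ}
include hL hf

theorem exists_monotoneOn_of_tendsto {l : ℝ} (hl : Tendsto f (𝓝[>] a) (𝓝 l))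
    (hlt : ∀ᶠ x in 𝓝[>] a, l < f x) : ∃ b > a, MonotoneOn f (Set.Ioo a b) := by
  obtain ⟨b, hab, hmono | hanti⟩ := hL.exists_monotoneOn_or_antitoneOn hf a
  · exact ⟨b, hab, hmono⟩
  obtain ⟨x, hlx, hx⟩ := (hlt.and (Ioo_mem_nhdsGT hab)).exists
  have hle : f x ≤ l := ge_of_tendsto hl <| by
    filter_upwards [Ioo_mem_nhdsGT hx.1] with y hy
    exact hanti ⟨hy.1, hy.2.trans hx.2⟩ hx hy.2.le
  exact absurd hle hlx.not_ge

theorem exists_antitoneOn_of_tendsto_atTop (hl : Tendsto f (𝓝[>] a) atTop) :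
    ∃ b > a, AntitoneOn f (Set.Ioo a b) := by
  obtain ⟨b, hab, hmono | hanti⟩ := hL.exists_monotoneOn_or_antitoneOn hf a
  · obtain ⟨x, hx⟩ := Set.nonempty_Ioo.2 hab
    obtain ⟨y, hxy, hy⟩ := ((hl.eventually_gt_atTop (f x)).and (Ioo_mem_nhdsGT hx.1)).exists
    exact absurd (hmono ⟨hy.1, hy.2.trans hx.2⟩ hx hy.2.le) hxy.not_ge
  · exact ⟨b, hab, hanti⟩

end IsOMinimalExpansion

theorem mul_deriv_le_of_antitoneOn_div_pow {f : ℝ → ℝ} {b t : ℝ} {k : ℕ}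
    (hanti : AntitoneOn (fun s => f s / s ^ k) (Set.Ioo 0 b)) (ht : t ∈ Set.Ioo 0 b)
    (hf : DifferentiableAt ℝ f t) : t * deriv f t ≤ k * f t := by
  set g : ℝ → ℝ := fun s => f s / s ^ k
  have hI : Set.Ioo 0 b ∈ 𝓝 t := Ioo_mem_nhds ht.1 ht.2
  have hg : DifferentiableAt ℝ g t := hf.div (by fun_prop) (pow_pos ht.1 k).ne'
  have hg' : deriv g t ≤ 0 := by
    rw [← derivWithin_of_mem_nhds hI]
    exact hanti.derivWithin_nonpos
  have hfg : f =ᶠ[𝓝 t] fun s => g s * s ^ k := by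
    filter_upwards [hI] with s hs
    exact (div_mul_cancel₀ _ (pow_pos hs.1 k).ne').symm
  have hderiv : t * deriv f t = k * f t + t ^ (k + 1) * deriv g t := by
    rw [hfg.deriv_eq, (hg.hasDerivAt.fun_mul (hasDerivAt_pow k t)).deriv, hfg.self_of_nhds]
    rcases k with _ | k
    · simp
    · simp only [Nat.add_sub_cancel]
      ring
  rw [hderiv]
  exact add_le_of_nonpos_right (mul_nonpos_of_nonneg_of_nonpos (pow_pos ht.1 _).le hg')

namespace IsPolynomiallyBounded

variable (hpb : IsPolynomiallyBounded L) (hL : IsOMinimalExpansion L)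
include hpb hL

variable {f : ℝ → ℝ} (hf : DefinableMap L f)
include hf

theorem exists_eventually_pow_le (hpos : ∀ᶠ t in 𝓝[>] 0, 0 < f t) :
    ∃ N : ℕ, ∀ᶠ t in 𝓝[>] 0, t ^ N ≤ f t := by
  have hgraph : DefinablePred L fun p : ℝ × ℝ => p.2 = (f p.1⁻¹)⁻¹ := by
    fun_prop (disch := assumption)
  obtain ⟨N, hN⟩ := hpb (fun s => (f s⁻¹)⁻¹) <| hgraph.comp (f := fun v : Fin 2 → ℝ => (v 0, v 1))
    (.prodMk (.coord (E := Fin 2 → ℝ) (0 : Fin 2)) (.coord (E := Fin 2 → ℝ) (1 : Fin 2)))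
  refine ⟨N, ?_⟩
  filter_upwards [tendsto_inv_nhdsGT_zero.eventually hN, hpos, self_mem_nhdsWithin] with t ht hft h0
  rw [inv_inv, abs_of_pos (inv_pos.2 hft), inv_pow] at ht
  exact (inv_le_inv₀ hft (pow_pos h0 N)).1 ht

theorem isBigO_mul_deriv_of_pos (hpos : ∀ᶠ t in 𝓝[>] 0, 0 < f t)
    (h0 : Tendsto f (𝓝[>] 0) (𝓝 0)) : (fun t => t * deriv f t) =O[𝓝[>] 0] f := by
  obtain ⟨N, hN⟩ := hpb.exists_eventually_pow_le hL hf hpos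
  have hdiv : Tendsto (fun t => f t / t ^ (N + 1)) (𝓝[>] 0) atTop := by
    refine tendsto_atTop_mono' _ ?_ tendsto_inv_nhdsGT_zero
    filter_upwards [hN, self_mem_nhdsWithin] with t ht (h0 : 0 < t)
    calc t⁻¹ = t ^ N / t ^ (N + 1) := by rw [pow_succ]; field_simp
      _ ≤ f t / t ^ (N + 1) := by gcongr
  obtain ⟨b, hb, hmono⟩ := hL.exists_monotoneOn_of_tendsto hf h0 hpos
  obtain ⟨c, hc, hanti⟩ := hL.exists_antitoneOn_of_tendsto_atTop
    (by fun_prop (disch := assumption)) hdiv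
  refine .of_bound (N + 1 : ℕ) ?_
  filter_upwards [hpos, hL.eventually_differentiableAt hf 0, Ioo_mem_nhdsGT hb, Ioo_mem_nhdsGT hc]
    with t hft hd htb htc
  have hderiv : 0 ≤ deriv f t := by
    rw [← derivWithin_of_mem_nhds (Ioo_mem_nhds htb.1 htb.2)]
    exact hmono.derivWithin_nonneg
  rw [Real.norm_of_nonneg (mul_nonneg htb.1.le hderiv), Real.norm_of_nonneg hft.le]
  exact mul_deriv_le_of_antitoneOn_div_pow hanti htc hd

theorem isBigO_mul_deriv (h0 : Tendsto f (𝓝[>] 0) (𝓝 0)) :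
    (fun t => t * deriv f t) =O[𝓝[>] 0] f := by
  rcases (hL.decidesDefinable_nhdsGT 0).eventually_pos_or_eq_zero_or_neg hL hf with h | h | h
  · exact hpb.isBigO_mul_deriv_of_pos hL hf h h0
  · refine .of_bound 0 ?_
    filter_upwards [eventually_nhdsGT_eventually_nhds h] with t ht
    have ht : f =ᶠ[𝓝 t] fun _ => 0 := ht
    simp [ht.deriv_eq]
  · simpa [deriv.fun_neg, Asymptotics.isBigO_neg_left, Asymptotics.isBigO_neg_right] using
      hpb.isBigO_mul_deriv_of_pos hL (f := fun t => -f t) (hf.neg hL)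
        (h.mono fun t ht => neg_pos.2 ht) (by simpa using h0.neg)

theorem tendsto_mul_deriv {C : ℝ} (hC : ∀ᶠ t in 𝓝[>] 0, |f t| ≤ C) :
    Tendsto (fun t => t * deriv f t) (𝓝[>] 0) (𝓝 0) := by
  obtain ⟨l, hl⟩ := hL.exists_tendsto_nhdsGT hf hC
  have h0 : Tendsto (fun t => f t - l) (𝓝[>] 0) (𝓝 0) := by simpa using hl.sub_const l
  simpa using (hpb.isBigO_mul_deriv hL (by fun_prop (disch := assumption)) h0).trans_tendsto h0

end IsPolynomiallyBounded

section Euclidean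

variable {n : ℕ} {u : ℝ → EuclideanSpace ℝ (Fin n)}

theorem IsOMinimalExpansion.eventually_differentiableAt_euclidean (hL : IsOMinimalExpansion L)
    (hu : DefinableMap L u) (a : ℝ) : ∀ᶠ t in 𝓝[>] a, DifferentiableAt ℝ u t := by
  simp only [differentiableAt_euclidean, eventually_all]
  exact fun i => hL.eventually_differentiableAt (hu.euclidean_apply i) a

theorem deriv_euclidean_apply {t : ℝ} (hu : DifferentiableAt ℝ u t) (i : Fin n) :
    deriv u t i = deriv (fun s => u s i) t :=
  ((EuclideanSpace.proj i : _ →L[ℝ] ℝ).hasFDerivAt.comp_hasDerivAt t hu.hasDerivAt).deriv.symm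

theorem IsPolynomiallyBounded.tendsto_smul_deriv (hpb : IsPolynomiallyBounded L)
    (hL : IsOMinimalExpansion L) (hu : DefinableMap L u) {C : ℝ}
    (hC : ∀ᶠ t in 𝓝[>] 0, ‖u t‖ ≤ C) : Tendsto (fun t => t • deriv u t) (𝓝[>] 0) (𝓝 0) := by
  rw [(EuclideanSpace.equiv (Fin n) ℝ).toHomeomorph.isInducing.tendsto_nhds_iff, tendsto_pi_nhds]
  intro i
  refine (hpb.tendsto_mul_deriv hL (hu.euclidean_apply i)
    (hC.mono fun t ht => (PiLp.norm_apply_le (u t) i).trans ht)).congr' ?_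
  filter_upwards [hL.eventually_differentiableAt_euclidean hu 0] with t ht
  simp [deriv_euclidean_apply ht]

end Euclidean

end PolynomiallyBounded

section Choice

theorem half_add_sSup_mem {s : Set ℝ} {a : ℝ} (h : ∀ᶠ x in 𝓝[>] a, x ∈ s) :
    (a + sSup {b | b ≤ a + 1 ∧ ∀ x, a < x → x < b → x ∈ s}) / 2 ∈ s := by
  set T := {b | b ≤ a + 1 ∧ ∀ x, a < x → x < b → x ∈ s}
  have hbdd : BddAbove T := ⟨a + 1, fun b hb => hb.1⟩
  obtain ⟨c, hac, hc⟩ := mem_nhdsGT_iff_exists_Ioo_subset.1 h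
  have hmem : min c (a + 1) ∈ T :=
    ⟨min_le_right _ _, fun x hax hx => hc ⟨hax, hx.trans_le (min_le_left _ _)⟩⟩
  have hlt : a < sSup T := (lt_min hac (lt_add_one a)).trans_le (le_csSup hbdd hmem)
  obtain ⟨b, hb, hlb⟩ := exists_lt_of_lt_csSup ⟨_, hmem⟩
    (show (a + sSup T) / 2 < sSup T by linarith)
  exact hb.2 _ (by linarith) hlb

variable {L : FirstOrder.Language} [L.Structure ℝ]
variable {E F : Type} [RealCoordinates E] [RealCoordinates F]

section

variable (hL : IsOMinimalExpansion L) {S : E → Set ℝ}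
  (hS : DefinablePred L fun q : E × ℝ => q.2 ∈ S q.1)
include hL hS

theorem DefinablePred.isLUB : DefinablePred L fun q : E × ℝ => IsLUB (S q.1) q.2 := by
  have hub : DefinablePred L fun q : E × ℝ => ∀ x, x ∈ S q.1 → x ≤ q.2 :=
    .forall (.imp (hS.comp (f := fun r : (E × ℝ) × ℝ => (r.1.1, r.2)) (by fun_prop))
      (by fun_prop (disch := assumption)))
  refine hub.and (.forall (P := fun (q : E × ℝ) (b : ℝ) => (∀ x, x ∈ S q.1 → x ≤ b) → q.2 ≤ b)
    (.imp (hub.comp (f := fun r : (E × ℝ) × ℝ => (r.1.1, r.2)) (by fun_prop))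
      (by fun_prop (disch := assumption))))

theorem DefinableMap.sSup : DefinableMap L fun p => sSup (S p) := by
  refine .of_graph ((?_ : DefinablePred L fun q : E × ℝ =>
    IsLUB (S q.1) q.2 ∨ (¬∃ x, IsLUB (S q.1) x) ∧ q.2 = 0).congr fun q => ?_)
  · have := DefinablePred.isLUB hL hS
    refine .or this (.and (.not (.exists ?_)) (by fun_prop))
    exact this.comp (f := fun r : (E × ℝ) × ℝ => (r.1.1, r.2)) (by fun_prop)
  · by_cases h : (S q.1).Nonempty ∧ BddAbove (S q.1)
    · have hlub := isLUB_csSup h.1 h.2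
      simp only [show ∃ x, IsLUB (S q.1) x from ⟨_, hlub⟩, not_true_eq_false, false_and, or_false]
      exact ⟨fun h => h ▸ hlub, hlub.unique⟩
    · have hlub : ∀ x, ¬IsLUB (S q.1) x := fun x hx => h ⟨hx.nonempty, x, hx.1⟩
      have h0 : SupSet.sSup (S q.1) = 0 := by
        rcases not_and_or.1 h with h | h
        · rw [Set.not_nonempty_iff_eq_empty.1 h, Real.sSup_empty]
        · exact Real.sSup_of_not_bddAbove h
      simp [hlub, h0, eq_comm]

theorem DefinableMap.sInf : DefinableMap L fun p => sInf (S p) := by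
  simp only [Real.sInf_def]
  exact neg hL (sSup hL (hS.comp (f := fun q : E × ℝ => (q.1, -q.2))
    (by fun_prop (disch := assumption))))

end

namespace IsOMinimalExpansion

variable (hL : IsOMinimalExpansion L)
include hL

theorem eventually_nhdsGT_of_isGLB {P : ℝ → Prop} (hP : DefinablePred L P) {a : ℝ}
    (ha : IsGLB {x | P x} a) (hPa : ¬P a) : ∀ᶠ x in 𝓝[>] a, P x := by
  refine (hL.decidesDefinable_nhdsGT a).eventually_of_frequently hP (frequently_iff.2 fun hU => ?_)
  obtain ⟨b, hab, hb⟩ := mem_nhdsGT_iff_exists_Ioo_subset.1 hU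
  obtain ⟨x, hx, hxb⟩ := (isGLB_lt_iff ha).1 hab
  have hax : a < x := (ha.1 hx).lt_of_ne fun h => hPa (h ▸ hx)
  exact ⟨x, hb ⟨hax, hxb⟩, hx⟩

theorem exists_definable_choice_of_nonneg {P : E → ℝ → Prop}
    (hP : DefinablePred L fun q : E × ℝ => P q.1 q.2) (h0 : ∀ p x, P p x → 0 ≤ x) :
    ∃ c : E → ℝ, DefinableMap L c ∧ ∀ p, (∃ x, P p x) → P p (c p) := by
  classical
  let a : E → ℝ := fun p => sInf {x | P p x}
  let b : E → ℝ := fun p => sSup {b | b ≤ a p + 1 ∧ ∀ x, a p < x → x < b → x ∈ {x | P p x}}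
  have ha : DefinableMap L a := .sInf hL hP
  have hb : DefinableMap L b := by
    refine .sSup hL (.and (by fun_prop (disch := assumption)) (.forall (.imp ?_ (.imp ?_ ?_))))
    · fun_prop (disch := assumption)
    · fun_prop (disch := assumption)
    · exact hP.comp (f := fun r : (E × ℝ) × ℝ => (r.1.1, r.2)) (by fun_prop)
  refine ⟨fun p => if P p (a p) then a p else (a p + b p) / 2,
    .ite (hP.comp₂ .id ha) ha (by fun_prop (disch := assumption)), fun p hp => ?_⟩
  dsimp only
  split_ifs with hpa
  · exact hpa
  · exact half_add_sSup_mem (hL.eventually_nhdsGT_of_isGLB (hP.comp₂ (.const p) .id)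
      (isGLB_csInf hp ⟨0, fun x hx => h0 p x hx⟩) hpa)

theorem exists_definable_choice_real {P : E → ℝ → Prop}
    (hP : DefinablePred L fun q : E × ℝ => P q.1 q.2) :
    ∃ c : E → ℝ, DefinableMap L c ∧ ∀ p, (∃ x, P p x) → P p (c p) := by
  classical
  have hneg : DefinablePred L fun q : E × ℝ => P q.1 (-q.2) :=
    hP.comp (f := fun q : E × ℝ => (q.1, -q.2)) (by fun_prop (disch := assumption))
  obtain ⟨r, hr, hPr⟩ := hL.exists_definable_choice_of_nonneg
    (P := fun p r => 0 ≤ r ∧ (P p r ∨ P p (-r)))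
    (.and (by fun_prop (disch := assumption)) (hP.or hneg)) fun p r h => h.1
  refine ⟨fun p => if P p (r p) then r p else -r p,
    .ite (hP.comp₂ .id hr) hr (hr.neg hL), fun p ⟨x, hx⟩ => ?_⟩
  have hPr := (hPr p ⟨|x|, abs_nonneg x, by rcases abs_choice x with h | h <;> simp [h, hx]⟩).2
  dsimp only
  split_ifs with h
  · exact h
  · exact hPr.resolve_left h

theorem exists_definable_choice_pi {m : ℕ} {P : E → (Fin m → ℝ) → Prop}
    (hP : DefinablePred L fun q : E × (Fin m → ℝ) => P q.1 q.2) :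
    ∃ c : E → Fin m → ℝ, DefinableMap L c ∧ ∀ p, (∃ w, P p w) → P p (c p) := by
  induction m with
  | zero =>
    refine ⟨fun _ => 0, .const _, fun p ⟨w, hw⟩ => ?_⟩
    rwa [Subsingleton.elim (0 : Fin 0 → ℝ) w]
  | succ m ih =>
    have hcons : ∀ {G : Type} [RealCoordinates G] {f : G → ℝ} {g : G → Fin m → ℝ},
        DefinableMap L f → DefinableMap L g →
        DefinableMap L fun p => (Fin.cons (f p) (g p) : Fin (m + 1) → ℝ) := fun hf hg =>
      .of_coords (Fin.forall_fin_succ.2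
        ⟨hf, fun i => (DefinableMap.coord (E := Fin m → ℝ) i).comp hg⟩)
    obtain ⟨c₁, hc₁, hP₁⟩ := hL.exists_definable_choice_real
      (P := fun p a => ∃ w : Fin m → ℝ, P p (Fin.cons a w))
      (.exists (hP.comp₂ (by fun_prop)
        (hcons (f := fun r : (E × ℝ) × (Fin m → ℝ) => r.1.2) (by fun_prop) (.snd .id))))
    obtain ⟨c₂, hc₂, hP₂⟩ := ih (P := fun p w => P p (Fin.cons (c₁ p) w))
      (hP.comp₂ (by fun_prop) (hcons (by fun_prop) (by fun_prop)))
    refine ⟨fun p => Fin.cons (c₁ p) (c₂ p), hcons hc₁ hc₂, fun p ⟨w, hw⟩ => hP₂ p (hP₁ p ?_)⟩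
    exact ⟨w 0, Fin.tail w, by rwa [Fin.cons_self_tail]⟩

theorem exists_definable_choice {P : E → F → Prop}
    (hP : DefinablePred L fun q : E × F => P q.1 q.2) :
    ∃ c : E → F, DefinableMap L c ∧ ∀ p, (∃ x, P p x) → P p (c p) := by
  let e : index F ≃ Fin (Nat.card (index F)) := Finite.equivFin _
  let ofFin : (Fin (Nat.card (index F)) → ℝ) ≃ F := (e.arrowCongr (.refl ℝ)).symm.trans coords.symm
  have hofFin : DefinableMap L ofFin := .of_coords fun i => by
    simpa [ofFin] using! DefinableMap.coord (E := Fin (Nat.card (index F)) → ℝ) (e i)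
  obtain ⟨c, hc, hPc⟩ := hL.exists_definable_choice_pi (P := fun p w => P p (ofFin w))
    (hP.comp₂ (by fun_prop) (by fun_prop))
  exact ⟨fun p => ofFin (c p), by fun_prop,
    fun p ⟨x, hx⟩ => hPc p ⟨ofFin.symm x, by rwa [Equiv.apply_symm_apply]⟩⟩

end IsOMinimalExpansion

end Choice

section Submanifold

open Asymptotics

theorem exists_continuousLinearEquiv_hasFDerivAt {E F : Type*} [NormedAddCommGroup E]
    [NormedSpace ℝ E] [NormedAddCommGroup F] [NormedSpace ℝ F] (Φ : OpenPartialHomeomorph E F)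
    {x : E} (hx : x ∈ Φ.source) (h : DifferentiableAt ℝ Φ x)
    (h' : DifferentiableAt ℝ Φ.symm (Φ x)) :
    ∃ D : E ≃L[ℝ] F, HasFDerivAt Φ (D : E →L[ℝ] F) x ∧
      HasFDerivAt Φ.symm (D.symm : F →L[ℝ] E) (Φ x) := by
  have hleft : (fderiv ℝ Φ.symm (Φ x)).comp (fderiv ℝ Φ x) = .id ℝ E :=
    (h'.hasFDerivAt.comp x h.hasFDerivAt).unique
      ((hasFDerivAt_id x).congr_of_eventuallyEq (Φ.eventually_left_inverse hx))
  have hright : (fderiv ℝ Φ x).comp (fderiv ℝ Φ.symm (Φ x)) = .id ℝ F := by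
    refine HasFDerivAt.unique (HasFDerivAt.comp (Φ x) ?_ h'.hasFDerivAt)
      ((hasFDerivAt_id (Φ x)).congr_of_eventuallyEq
        (Φ.eventually_right_inverse (Φ.map_source hx)))
    rw [Φ.left_inv hx]
    exact h.hasFDerivAt
  exact ⟨.equivOfInverse _ _ (DFunLike.congr_fun hleft) (DFunLike.congr_fun hright),
    h.hasFDerivAt, h'.hasFDerivAt⟩

variable {n d : ℕ}

local notation "𝔼" => EuclideanSpace ℝ (Fin n)

variable {M : Set (EuclideanSpace ℝ (Fin n))} {y u v : EuclideanSpace ℝ (Fin n)}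

theorem mem_tangentSpaceAt_of_hasDerivAt {γ : ℝ → 𝔼} {t : ℝ} (hM : ∀ᶠ s in 𝓝 t, γ s ∈ M)
    (hγ : HasDerivAt γ v t) : v ∈ tangentSpaceAt M (γ t) := by
  have hc : Tendsto (fun s : ℝ => s + t) (𝓝 0) (𝓝 t) := by
    simpa using (continuous_add_const t).tendsto 0
  refine Submodule.subset_span ⟨fun s => γ (s + t), by simp, hc.eventually hM, ?_⟩
  exact HasDerivAt.comp_add_const 0 t (by simpa using hγ)

theorem tangentSpaceAt_submodule (V : Submodule ℝ 𝔼) (hy : y ∈ V) :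
    tangentSpaceAt (V : Set 𝔼) y = V := by
  refine le_antisymm (Submodule.span_le.2 ?_) fun v hv => ?_
  · rintro v ⟨γ, -, hγV, hγ⟩
    rw [← V.orthogonal_orthogonal]
    refine (Submodule.mem_orthogonal _ _).2 fun u hu => ?_
    have huγ : HasDerivAt (fun t => inner ℝ u (γ t)) (inner ℝ u v) 0 := by
      simpa using (hasDerivAt_const 0 u).inner ℝ hγ
    refine huγ.unique ((hasDerivAt_const 0 (0 : ℝ)).congr_of_eventuallyEq ?_)
    filter_upwards [hγV] with t ht using Submodule.inner_left_of_mem_orthogonal ht hu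
  · have hline : HasDerivAt (fun t : ℝ => y + t • v) v 0 := by
      simpa using ((hasDerivAt_id (0 : ℝ)).smul_const v).const_add y
    simpa using mem_tangentSpaceAt_of_hasDerivAt (M := V)
      (.of_forall fun t => V.add_mem hy (V.smul_mem t hv)) hline

/-- The chart `Φ` of the ambient space is of class `C²` and straightens `M` to the linear subspace
`V`, as the charts in the definition of a submanifold do. -/
structure IsStraightening (Φ : OpenPartialHomeomorph 𝔼 𝔼) (M : Set 𝔼) (V : Submodule ℝ 𝔼) :
    Prop where
  contDiffOn : ContDiffOn ℝ 2 Φ Φ.source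
  contDiffOn_symm : ContDiffOn ℝ 2 Φ.symm Φ.target
  mem_iff : ∀ z ∈ Φ.source, (z ∈ M ↔ Φ z ∈ V)

theorem IsC2Submanifold.exists_isStraightening (hM : IsC2Submanifold d M) (hy : y ∈ M) :
    ∃ Φ V, IsStraightening Φ M V ∧ y ∈ Φ.source ∧ Module.finrank ℝ V = d := by
  obtain ⟨Φ, V, hyΦ, hΦ, hΦ', hV, hiff⟩ := hM y hy
  exact ⟨Φ, V, ⟨hΦ, hΦ', hiff⟩, hyΦ, hV⟩

namespace IsStraightening

variable {Φ : OpenPartialHomeomorph (EuclideanSpace ℝ (Fin n)) (EuclideanSpace ℝ (Fin n))}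
  {V : Submodule ℝ (EuclideanSpace ℝ (Fin n))} (h : IsStraightening Φ M V)
include h

theorem symm_mem_iff {w : 𝔼} (hw : w ∈ Φ.target) : Φ.symm w ∈ M ↔ w ∈ V := by
  rw [h.mem_iff _ (Φ.map_target hw), Φ.right_inv hw]

theorem contDiffAt (hy : y ∈ Φ.source) : ContDiffAt ℝ 2 Φ y :=
  h.contDiffOn.contDiffAt (Φ.open_source.mem_nhds hy)

theorem contDiffAt_symm {w : 𝔼} (hw : w ∈ Φ.target) : ContDiffAt ℝ 2 Φ.symm w :=
  h.contDiffOn_symm.contDiffAt (Φ.open_target.mem_nhds hw)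

theorem exists_hasFDerivAt (hy : y ∈ Φ.source) :
    ∃ D : 𝔼 ≃L[ℝ] 𝔼, HasFDerivAt Φ (D : 𝔼 →L[ℝ] 𝔼) y ∧
      HasFDerivAt Φ.symm (D.symm : 𝔼 →L[ℝ] 𝔼) (Φ y) :=
  exists_continuousLinearEquiv_hasFDerivAt Φ hy
    ((h.contDiffAt hy).differentiableAt two_ne_zero)
    ((h.contDiffAt_symm (Φ.map_source hy)).differentiableAt two_ne_zero)

theorem tangentSpaceAt_eq_comap (hyΦ : y ∈ Φ.source) (hy : y ∈ M) {D : 𝔼 ≃L[ℝ] 𝔼}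
    (hD : HasFDerivAt Φ (D : 𝔼 →L[ℝ] 𝔼) y) (hD' : HasFDerivAt Φ.symm (D.symm : 𝔼 →L[ℝ] 𝔼) (Φ y)) :
    tangentSpaceAt M y = V.comap (D : 𝔼 →ₗ[ℝ] 𝔼) := by
  have hyV : Φ y ∈ V := (h.mem_iff y hyΦ).1 hy
  refine le_antisymm (Submodule.span_le.2 ?_) fun v hv => ?_
  · rintro v ⟨γ, rfl, hγM, hγ⟩
    have hΦγ : ∀ᶠ t in 𝓝 0, Φ (γ t) ∈ V := by
      filter_upwards [hγM, hγ.continuousAt.eventually (Φ.open_source.mem_nhds hyΦ)] with t ht htΦ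
      exact (h.mem_iff _ htΦ).1 ht
    have := mem_tangentSpaceAt_of_hasDerivAt (M := V) hΦγ (hD.comp_hasDerivAt 0 hγ)
    rwa [Function.comp_apply, tangentSpaceAt_submodule V hyV] at this
  · let γ : ℝ → 𝔼 := fun t => Φ y + t • D v
    have hγ0 : γ 0 = Φ y := by simp [γ]
    have hγ : HasDerivAt γ (D v) 0 := by
      simpa [γ] using ((hasDerivAt_id (0 : ℝ)).smul_const (D v)).const_add (Φ y)
    have hγΦ : ∀ᶠ t in 𝓝 0, γ t ∈ Φ.target :=
      hγ.continuousAt.eventually (Φ.open_target.mem_nhds (hγ0 ▸ Φ.map_source hyΦ))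
    have hM : ∀ᶠ t in 𝓝 0, Φ.symm (γ t) ∈ M := by
      filter_upwards [hγΦ] with t ht
      exact (h.symm_mem_iff ht).2 (V.add_mem hyV (V.smul_mem t hv))
    have := mem_tangentSpaceAt_of_hasDerivAt hM ((hγ0 ▸ hD').comp_hasDerivAt 0 hγ)
    simpa [hγ0, Φ.left_inv hyΦ] using this

end IsStraightening

theorem IsC2Submanifold.finrank_tangentSpaceAt (hM : IsC2Submanifold d M) (hy : y ∈ M) :
    Module.finrank ℝ (tangentSpaceAt M y) = d := by
  obtain ⟨Φ, V, h, hyΦ, rfl⟩ := hM.exists_isStraightening hy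
  obtain ⟨D, hD, hD'⟩ := h.exists_hasFDerivAt hyΦ
  rw [h.tangentSpaceAt_eq_comap hyΦ hy hD hD']
  exact (D.toLinearEquiv.submoduleMap _).finrank_eq.trans
    (by rw [Submodule.map_comap_eq_of_surjective D.surjective])

/-- `u` is normal to `M` at `y`: the distance of a point `z` of `M` from the hyperplane
through `y` orthogonal to `u` is `o(‖z - y‖)`. Unlike the definition of the tangent space, this
quantifies over points instead of curves, so it is definable when `M` is. -/
def IsNormalAt (M : Set 𝔼) (y u : 𝔼) : Prop :=
  (fun z : 𝔼 => inner ℝ u (z - y)) =o[𝓝[M] y] fun z => z - y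

theorem IsNormalAt.inner_eq_zero_of_hasDerivAt (hu : IsNormalAt M y u) {γ : ℝ → 𝔼} (h0 : γ 0 = y)
    (hM : ∀ᶠ t in 𝓝 0, γ t ∈ M) (hγ : HasDerivAt γ v 0) : inner ℝ u v = 0 := by
  have huγ : HasDerivAt (fun t => inner ℝ u (γ t)) (inner ℝ u v) 0 := by
    simpa using (hasDerivAt_const 0 u).inner ℝ hγ
  have hγy : Tendsto γ (𝓝 0) (𝓝[M] y) :=
    tendsto_nhdsWithin_iff.2 ⟨h0 ▸ hγ.continuousAt.tendsto, hM⟩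
  have hO : (fun t => γ t - y) =O[𝓝 0] fun t => t - 0 := by simpa [h0] using hγ.isBigO_sub
  refine huγ.unique (hasDerivAt_iff_isLittleO.2 ?_)
  simpa [Function.comp_def, inner_sub_right, h0] using (hu.comp_tendsto hγy).trans_isBigO hO

theorem IsC2Submanifold.isNormalAt_iff (hM : IsC2Submanifold d M) (hy : y ∈ M) :
    IsNormalAt M y u ↔ u ∈ (tangentSpaceAt M y)ᗮ := by
  refine ⟨fun hu => (Submodule.mem_orthogonal' _ _).2 fun v hv => ?_, fun hu => ?_⟩
  · induction hv using Submodule.span_induction with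
    | mem v hv =>
      obtain ⟨γ, h0, hγM, hγ⟩ := hv
      exact hu.inner_eq_zero_of_hasDerivAt h0 hγM hγ
    | zero => exact inner_zero_right u
    | add v w _ _ hv hw => rw [inner_add_right, hv, hw, add_zero]
    | smul c v _ hv => rw [inner_smul_right, hv, mul_zero]
  · obtain ⟨Φ, V, h, hyΦ, -⟩ := hM.exists_isStraightening hy
    obtain ⟨D, hD, hD'⟩ := h.exists_hasFDerivAt hyΦ
    have hzy : (fun z => z - y - D.symm (Φ z - Φ y)) =o[𝓝 y] fun z => z - y := by
      refine ((hD'.isLittleO.comp_tendsto hD.continuousAt.tendsto).trans_isBigO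
        hD.isBigO_sub).congr' ?_ .rfl
      filter_upwards [Φ.open_source.mem_nhds hyΦ] with z hz
      simp [Φ.left_inv hz, Φ.left_inv hyΦ]
    have hinner : (fun z => inner ℝ u (z - y - D.symm (Φ z - Φ y))) =o[𝓝[M] y] fun z => z - y :=
      (IsBigO.of_bound ‖u‖ (.of_forall fun z => norm_inner_le_norm _ _)).trans_isLittleO
        (hzy.mono nhdsWithin_le_nhds)
    refine hinner.congr' ?_ .rfl
    filter_upwards [nhdsWithin_le_nhds (Φ.open_source.mem_nhds hyΦ), self_mem_nhdsWithin]
      with z hzΦ hz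
    have hT : D.symm (Φ z - Φ y) ∈ tangentSpaceAt M y := by
      rw [h.tangentSpaceAt_eq_comap hyΦ hy hD hD']
      simpa using V.sub_mem ((h.mem_iff z hzΦ).1 hz) ((h.mem_iff y hyΦ).1 hy)
    rw [inner_sub_right, Submodule.inner_left_of_mem_orthogonal hT hu, sub_zero]

section Definable

variable {L : FirstOrder.Language} [L.Structure ℝ] (hL : IsOMinimalExpansion L)
  (hdef : IsDefinableSet L M)
include hL hdef

theorem definablePred_isNormalAt : DefinablePred L fun q : 𝔼 × 𝔼 => IsNormalAt M q.1 q.2 := by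
  have hM : DefinablePred L fun z : 𝔼 => z ∈ M := hdef
  simp only [IsNormalAt, isLittleO_iff, Real.norm_eq_abs]
  refine .forall (.imp (by fun_prop (disch := assumption)) ?_)
  exact .eventually_nhdsWithin hL (.dist_euclidean hL) (hM.comp (.snd .id))
    (by fun_prop (disch := assumption)) (by fun_prop)

theorem IsC2Submanifold.definablePred_mem_orthogonal (hM : IsC2Submanifold d M) :
    DefinablePred L fun q : 𝔼 × 𝔼 => q.1 ∈ M ∧ q.2 ∈ (tangentSpaceAt M q.1)ᗮ := by
  have hmem : DefinablePred L fun z : 𝔼 => z ∈ M := hdef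
  exact ((hmem.comp (.fst .id)).and (definablePred_isNormalAt hL hdef)).congr
    fun q => and_congr_right fun hq => (hM.isNormalAt_iff hq).symm

theorem IsC2Submanifold.definablePred_mem_tangentSpaceAt (hM : IsC2Submanifold d M) :
    DefinablePred L fun q : 𝔼 × 𝔼 => q.1 ∈ M ∧ q.2 ∈ tangentSpaceAt M q.1 := by
  have hmem : DefinablePred L fun z : 𝔼 => z ∈ M := hdef
  refine (?_ : DefinablePred L fun q : 𝔼 × 𝔼 => q.1 ∈ M ∧
    ∀ u, (q.1 ∈ M ∧ u ∈ (tangentSpaceAt M q.1)ᗮ) → inner ℝ u q.2 = 0).congr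
      fun q => and_congr_right fun hq => ?_
  · exact (hmem.comp (.fst .id)).and (.forall (.imp
      ((hM.definablePred_mem_orthogonal hL hdef).comp
        (f := fun p : (𝔼 × 𝔼) × 𝔼 => (p.1.1, p.2)) (by fun_prop))
      (by fun_prop (disch := assumption))))
  · rw [← (tangentSpaceAt M q.1).orthogonal_orthogonal, Submodule.mem_orthogonal]
    simp only [Submodule.orthogonal_orthogonal, hq, true_and]

end Definable

end Submanifold

section NearestPoint

/-- `x` is a point of `X` nearest to `y`. -/
def IsNearestPoint {α : Type*} [PseudoMetricSpace α] (X : Set α) (y x : α) : Prop :=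
  x ∈ X ∧ ∀ z ∈ X, dist y x ≤ dist y z

theorem IsNearestPoint.dist_le_two_mul {α : Type*} [PseudoMetricSpace α] {X : Set α} {y x z : α}
    (h : IsNearestPoint X y x) (hz : z ∈ X) : dist x z ≤ 2 * dist y z := by
  linarith [dist_triangle_left x z y, h.2 z hz]

theorem eventually_exists_isNearestPoint {α : Type*} [PseudoMetricSpace α] {X : Set α} {x₀ : α}
    {r : ℝ} (hr : 0 < r) (hX : IsCompact (X ∩ Metric.closedBall x₀ r)) (h0 : x₀ ∈ X) :
    ∀ᶠ y in 𝓝 x₀, ∃ x, IsNearestPoint X y x := by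
  filter_upwards [Metric.ball_mem_nhds x₀ (half_pos hr)] with y hy
  have hx₀ : x₀ ∈ X ∩ Metric.closedBall x₀ r := ⟨h0, Metric.mem_closedBall_self hr.le⟩
  obtain ⟨x, hx, hmin⟩ := hX.exists_isMinOn ⟨x₀, hx₀⟩
    (continuous_const.dist continuous_id : Continuous (dist y)).continuousOn
  refine ⟨x, hx.1, fun z hz => ?_⟩
  by_cases hzr : z ∈ Metric.closedBall x₀ r
  · exact hmin ⟨hz, hzr⟩
  · have hyx : dist y x ≤ dist y x₀ := hmin hx₀
    rw [Metric.mem_closedBall, not_le] at hzr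
    linarith [dist_triangle_left z x₀ y, Metric.mem_ball.1 hy]

theorem contDiffAt_deriv {E : Type*} [NormedAddCommGroup E] [NormedSpace ℝ E] {g : ℝ → E} {s : ℝ}
    {m : ℕ} (hg : ContDiffAt ℝ (m + 1) g s) : ContDiffAt ℝ m (deriv g) s := by
  simpa only [fderiv_apply_one_eq_deriv] using
    (hg.fderiv_right le_rfl).clm_apply (contDiffAt_const (c := (1 : ℝ)))

theorem hasDerivAt_norm_sub_sq {E : Type*} [NormedAddCommGroup E] [InnerProductSpace ℝ E]
    {g : ℝ → E} {s : ℝ} (hg : DifferentiableAt ℝ g s) (y : E) :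
    HasDerivAt (fun s => ‖y - g s‖ ^ 2) (2 * inner ℝ (g s - y) (deriv g s)) s := by
  simpa [inner_sub_left] using (hg.hasDerivAt.const_sub y).norm_sq

theorem deriv2_norm_sub_sq {E : Type*} [NormedAddCommGroup E] [InnerProductSpace ℝ E]
    {g : ℝ → E} {s : ℝ} (hg : ContDiffAt ℝ 2 g s) (y : E) :
    deriv^[2] (fun s => ‖y - g s‖ ^ 2) s =
      2 * (‖deriv g s‖ ^ 2 + inner ℝ (g s - y) (deriv (deriv g) s)) := by
  have hderiv : deriv (fun s => ‖y - g s‖ ^ 2) =ᶠ[𝓝 s]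
      fun s => 2 * inner ℝ (g s - y) (deriv g s) := by
    filter_upwards [hg.eventually (by simp)] with t ht
    exact (hasDerivAt_norm_sub_sq (ht.differentiableAt two_ne_zero) y).deriv
  have hg' := (contDiffAt_deriv (m := 1) hg).differentiableAt one_ne_zero
  have hderiv₂ := (((hg.differentiableAt two_ne_zero).hasDerivAt.sub_const y).inner ℝ
    hg'.hasDerivAt).const_mul 2
  rw [Function.iterate_succ_apply, Function.iterate_one, hderiv.deriv_eq, hderiv₂.deriv,
    real_inner_self_eq_norm_sq, add_comm]

theorem eventually_strictConvexOn_norm_sub_sq {E : Type*} [NormedAddCommGroup E]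
    [InnerProductSpace ℝ E] {g : ℝ → E} {s₀ : ℝ} (hg : ContDiffAt ℝ 2 g s₀)
    (hg' : deriv g s₀ ≠ 0) :
    ∀ᶠ r in 𝓝[>] (0 : ℝ), ∀ᶠ y in 𝓝 (g s₀),
      StrictConvexOn ℝ (Metric.ball s₀ r) fun s => ‖y - g s‖ ^ 2 := by
  have hpos : ∀ᶠ p in 𝓝 s₀ ×ˢ 𝓝 (g s₀),
      0 < ‖deriv g p.1‖ ^ 2 + inner ℝ (g p.1 - p.2) (deriv (deriv g) p.1) := by
    have hfst : ContinuousAt Prod.fst (s₀, g s₀) := continuousAt_fst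
    have hg₁ := contDiffAt_deriv (m := 1) hg
    have hg₂ := contDiffAt_deriv (m := 0) hg₁
    have : ContinuousAt (fun p : ℝ × E => ‖deriv g p.1‖ ^ 2 +
        inner ℝ (g p.1 - p.2) (deriv (deriv g) p.1)) (s₀, g s₀) :=
      ((hg₁.continuousAt.comp hfst).norm.pow 2).add
        (((hg.continuousAt.comp hfst).sub continuousAt_snd).inner (𝕜 := ℝ)
          (hg₂.continuousAt.comp hfst))
    rw [← nhds_prod_eq]
    exact this.eventually_const_lt (by simpa using pow_pos (norm_pos_iff.2 hg') 2)
  obtain ⟨S, hS, T, hT, hST⟩ := eventually_prod_iff.1 hpos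
  obtain ⟨r₀, hr₀, hball⟩ := Metric.eventually_nhds_iff_ball.1 ((hg.eventually (by simp)).and hS)
  filter_upwards [Ioo_mem_nhdsGT hr₀] with r hr
  filter_upwards [hT] with y hy
  replace hball := fun s hs => hball s (Metric.ball_subset_ball hr.2.le hs)
  refine strictConvexOn_of_deriv2_pos' (convex_ball s₀ r) (fun s hs => ?_) fun s hs => ?_
  · exact (hasDerivAt_norm_sub_sq ((hball s hs).1.differentiableAt two_ne_zero)
      y).continuousAt.continuousWithinAt
  · rw [deriv2_norm_sub_sq (hball s hs).1]
    exact mul_pos two_pos (hST (hball s hs).2 hy)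

variable {n d : ℕ} {X : Set (EuclideanSpace ℝ (Fin n))} {x₀ : EuclideanSpace ℝ (Fin n)}

local notation "𝔼" => EuclideanSpace ℝ (Fin n)

theorem IsNearestPoint.nearestPoint {y x : 𝔼} (h : IsNearestPoint X y x) :
    IsNearestPoint X y (nearestPoint X y) :=
  Classical.epsilon_spec (p := IsNearestPoint X y) ⟨x, h⟩

theorem definablePred_isNearestPoint {L : FirstOrder.Language} [L.Structure ℝ]
    (hL : IsOMinimalExpansion L) (hdef : IsDefinableSet L X) :
    DefinablePred L fun q : 𝔼 × 𝔼 => IsNearestPoint X q.1 q.2 := by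
  have hX : DefinablePred L fun z : 𝔼 => z ∈ X := hdef
  simp only [IsNearestPoint, dist_eq_norm]
  exact .and (hX.comp (.snd .id))
    (.forall (.imp (hX.comp (.snd .id)) (by fun_prop (disch := assumption))))

theorem IsC2Submanifold.exists_isCompact_inter_closedBall (hX : IsC2Submanifold d X)
    (h0 : x₀ ∈ X) : ∃ r > 0, IsCompact (X ∩ Metric.closedBall x₀ r) := by
  obtain ⟨Φ, V, h, h0Φ, -⟩ := hX.exists_isStraightening h0
  obtain ⟨r, hr, hrΦ⟩ := Metric.nhds_basis_closedBall.mem_iff.1 (Φ.open_source.mem_nhds h0Φ)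
  have hclosed : IsClosed (Metric.closedBall x₀ r ∩ Φ ⁻¹' (V : Set 𝔼)) :=
    (Φ.continuousOn.mono hrΦ).preimage_isClosed_of_isClosed Metric.isClosed_closedBall
      V.closed_of_finiteDimensional
  have heq : X ∩ Metric.closedBall x₀ r = Metric.closedBall x₀ r ∩ Φ ⁻¹' (V : Set 𝔼) := by
    rw [Set.inter_comm]
    exact Set.ext fun z => and_congr_right fun hz => h.mem_iff z (hrΦ hz)
  exact ⟨r, hr, heq ▸ (isCompact_closedBall x₀ r).of_isClosed_subset hclosed Set.inter_subset_left⟩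

theorem IsStraightening.map_symm_nhdsWithin {Φ : OpenPartialHomeomorph 𝔼 𝔼} {V : Submodule ℝ 𝔼}
    (h : IsStraightening Φ X V) (h0 : x₀ ∈ Φ.source) :
    map Φ.symm (𝓝[V] Φ x₀) = 𝓝[X] x₀ := by
  have hV : (V : Set 𝔼) =ᶠ[𝓝 (Φ x₀)] Φ.symm ⁻¹' X := by
    filter_upwards [Φ.open_target.mem_nhds (Φ.map_source h0)] with w hw
    exact propext (h.symm_mem_iff hw).symm
  rw [nhdsWithin_eq_iff_eventuallyEq.2 hV,
    Φ.symm.map_nhdsWithin_preimage_eq (Φ.map_source h0) X, Φ.left_inv h0]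

theorem IsC2Submanifold.exists_parametrization (hX : IsC2Submanifold 1 X) (h0 : x₀ ∈ X) :
    ∃ g : ℝ → 𝔼, ContDiffAt ℝ 2 g 0 ∧ deriv g 0 ≠ 0 ∧ g 0 = x₀ ∧ map g (𝓝 0) = 𝓝[X] x₀ := by
  obtain ⟨Φ, V, h, h0Φ, hV⟩ := hX.exists_isStraightening h0
  obtain ⟨D, -, hD'⟩ := h.exists_hasFDerivAt h0Φ
  let e : V ≃L[ℝ] ℝ := .ofFinrankEq (by simpa using hV)
  let p : V := ⟨Φ x₀, (h.mem_iff x₀ h0Φ).1 h0⟩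
  let l : ℝ → 𝔼 := fun s => (p + e.symm s : V)
  have hl : ContDiff ℝ 2 l :=
    contDiff_const.add (V.subtypeL.comp e.symm.toContinuousLinearMap).contDiff
  have hl0 : l 0 = Φ x₀ := by simp [l, p]
  have hlV : map l (𝓝 0) = 𝓝[V] Φ x₀ := by
    let φ : ℝ ≃ₜ V := e.symm.toHomeomorph.trans (Homeomorph.addLeft p)
    have hφ0 : φ 0 = p := by simp [φ]
    rw [← map_nhds_subtype_val p, ← hφ0, ← φ.map_nhds_eq, map_map]
    rfl
  have hg : HasDerivAt (Φ.symm ∘ l) (D.symm (e.symm 1 : V)) 0 :=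
    (hl0 ▸ hD').comp_hasDerivAt 0
      (((V.subtypeL.comp e.symm.toContinuousLinearMap).hasDerivAt).const_add (Φ x₀))
  refine ⟨Φ.symm ∘ l, ?_, ?_, by simp [hl0, Φ.left_inv h0Φ], ?_⟩
  · exact (h.contDiffAt_symm (hl0 ▸ Φ.map_source h0Φ)).comp 0 hl.contDiffAt
  · rw [hg.deriv]
    simp
  · rw [← map_map, hlV, h.map_symm_nhdsWithin h0Φ]

theorem IsC2Submanifold.eventually_isNearestPoint_unique (hX : IsC2Submanifold 1 X)
    (h0 : x₀ ∈ X) :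
    ∀ᶠ y in 𝓝 x₀, ∀ x x', IsNearestPoint X y x → IsNearestPoint X y x' → x = x' := by
  obtain ⟨g, hg, hg', rfl, hgX⟩ := hX.exists_parametrization h0
  have hmem : ∀ᶠ r in 𝓝[>] (0 : ℝ), ∀ s ∈ Metric.ball 0 r, g s ∈ X := by
    have : ∀ᶠ s in 𝓝 0, g s ∈ X := hgX.le self_mem_nhdsWithin
    obtain ⟨r, hr, hrX⟩ := Metric.eventually_nhds_iff_ball.1 this
    filter_upwards [Ioo_mem_nhdsGT hr] with r' hr' s hs
    exact hrX s (Metric.ball_subset_ball hr'.2.le hs)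
  obtain ⟨r, hconvex, hrX, hr⟩ :=
    ((eventually_strictConvexOn_norm_sub_sq hg hg').and (hmem.and self_mem_nhdsWithin)).exists
  have hnear : ∀ᶠ x in 𝓝[X] g 0, x ∈ g '' Metric.ball 0 r :=
    hgX ▸ image_mem_map (Metric.ball_mem_nhds 0 hr)
  obtain ⟨δ, hδ, hnear⟩ := Metric.eventually_nhds_iff.1 (eventually_nhdsWithin_iff.1 hnear)
  filter_upwards [hconvex, Metric.ball_mem_nhds (g 0) (half_pos hδ)] with y hy hyδ x x' hx hx'
  have hfoot : ∀ x, IsNearestPoint X y x →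
      ∃ s ∈ Metric.ball 0 r, g s = x ∧ IsMinOn (fun s => ‖y - g s‖ ^ 2) (Metric.ball 0 r) s := by
    intro x hx
    obtain ⟨s, hs, rfl⟩ := hnear
      (by linarith [hx.dist_le_two_mul h0, Metric.mem_ball.1 hyδ]) hx.1
    refine ⟨s, hs, rfl, fun t ht => ?_⟩
    have := hx.2 (g t) (hrX t ht)
    simp only [dist_eq_norm] at this
    simp only [Set.mem_ofPred_eq]
    gcongr
  obtain ⟨s, hs, rfl, hsmin⟩ := hfoot x hx
  obtain ⟨t, ht, rfl, htmin⟩ := hfoot x' hx'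
  rw [hy.eq_of_isMinOn hsmin htmin hs ht]

theorem IsC2Submanifold.eventually_isNearestPoint_iff (hX : IsC2Submanifold 1 X) (h0 : x₀ ∈ X) :
    ∀ᶠ y in 𝓝 x₀, ∀ x, IsNearestPoint X y x ↔ x = nearestPoint X y := by
  obtain ⟨r, hr, hcompact⟩ := hX.exists_isCompact_inter_closedBall h0
  filter_upwards [eventually_exists_isNearestPoint hr hcompact h0,
    hX.eventually_isNearestPoint_unique h0] with y ⟨x', hx'⟩ huniq x
  exact ⟨fun hx => huniq _ _ hx hx'.nearestPoint, fun hx => hx ▸ hx'.nearestPoint⟩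

end NearestPoint

section Angles

variable {n : ℕ}

local notation "𝔼" => EuclideanSpace ℝ (Fin n)

variable {A B : Submodule ℝ (EuclideanSpace ℝ (Fin n))}

theorem distToSubspace_eq_norm_starProjection (v : 𝔼) (B : Submodule ℝ 𝔼) :
    distToSubspace v B = ‖Bᗮ.starProjection v‖ := by
  set w := Bᗮ.starProjection v
  have hinner : ∀ u ∈ Bᗮ, inner ℝ v u = inner ℝ w u := fun u hu => by
    rw [← Submodule.starProjection_eq_self_iff.2 hu,
      ← Submodule.inner_starProjection_left_eq_right, Submodule.starProjection_eq_self_iff.2 hu]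
  have hle : ∀ r ∈ {r : ℝ | ∃ u ∈ Bᗮ, ‖u‖ = 1 ∧ r = inner ℝ v u}, r ≤ ‖w‖ := by
    rintro r ⟨u, hu, hu1, rfl⟩
    simpa [hinner u hu, hu1] using real_inner_le_norm w u
  refine le_antisymm (Real.sSup_le hle (norm_nonneg w)) ?_
  rcases eq_or_ne w 0 with hw | hw
  · rw [hw, norm_zero]
    refine Real.sSup_nonneg ?_
    rintro r ⟨u, hu, -, rfl⟩
    simp [hinner u hu, hw]
  · have hwB : ‖w‖⁻¹ • w ∈ Bᗮ := Bᗮ.smul_mem _ (Submodule.starProjection_apply_mem _ v)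
    refine le_csSup ⟨‖w‖, hle⟩ ⟨‖w‖⁻¹ • w, hwB, norm_smul_inv_norm hw, ?_⟩
    rw [hinner _ hwB, inner_smul_right, real_inner_self_eq_norm_mul_norm,
      inv_mul_cancel_left₀ (norm_ne_zero_iff.2 hw)]

theorem distToSubspace_nonneg (v : 𝔼) (B : Submodule ℝ 𝔼) : 0 ≤ distToSubspace v B := by
  rw [distToSubspace_eq_norm_starProjection]
  exact norm_nonneg _

theorem distToSubspace_le_norm (v : 𝔼) (B : Submodule ℝ 𝔼) : distToSubspace v B ≤ ‖v‖ := by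
  rw [distToSubspace_eq_norm_starProjection]
  exact Submodule.norm_starProjection_apply_le _ v

theorem distToSubspace_smul (c : ℝ) (v : 𝔼) (B : Submodule ℝ 𝔼) :
    distToSubspace (c • v) B = |c| * distToSubspace v B := by
  simp [distToSubspace_eq_norm_starProjection, norm_smul]

theorem distToSubspace_add_le (v w : 𝔼) (B : Submodule ℝ 𝔼) :
    distToSubspace (v + w) B ≤ distToSubspace v B + distToSubspace w B := by
  simp only [distToSubspace_eq_norm_starProjection, map_add]
  exact norm_add_le _ _

theorem distToSubspace_eq_of_add_mem {v w : 𝔼} (h : v + w ∈ B) :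
    distToSubspace v B = distToSubspace w B := by
  have h0 : Bᗮ.starProjection v + Bᗮ.starProjection w = 0 := by
    rw [← map_add, Submodule.starProjection_apply_eq_zero_iff]
    exact B.le_orthogonal_orthogonal h
  simp only [distToSubspace_eq_norm_starProjection]
  rw [eq_neg_of_add_eq_zero_left h0, norm_neg]

theorem lt_sSup_iff_of_nonneg {s : Set ℝ} (hs : BddAbove s) {r : ℝ} (hr : 0 ≤ r) :
    r < sSup s ↔ ∃ a ∈ s, r < a := by
  rcases s.eq_empty_or_nonempty with rfl | hne
  · simpa using hr
  · exact lt_csSup_iff hs hne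

theorem lt_distToSubspace_iff {v : 𝔼} {r : ℝ} (hr : 0 ≤ r) :
    r < distToSubspace v B ↔ ∃ u ∈ Bᗮ, ‖u‖ = 1 ∧ r < inner ℝ v u := by
  rw [distToSubspace, lt_sSup_iff_of_nonneg _ hr]
  · constructor
    · rintro ⟨_, ⟨u, hu, hu1, rfl⟩, h⟩
      exact ⟨u, hu, hu1, h⟩
    · rintro ⟨u, hu, hu1, h⟩
      exact ⟨_, ⟨u, hu, hu1, rfl⟩, h⟩
  · refine ⟨‖v‖, ?_⟩
    rintro _ ⟨u, -, hu1, rfl⟩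
    simpa [hu1] using real_inner_le_norm v u

theorem lt_subspaceDelta_iff {r : ℝ} (hr : 0 ≤ r) :
    r < subspaceDelta A B ↔ ∃ v ∈ A, ‖v‖ = 1 ∧ ∃ u ∈ Bᗮ, ‖u‖ = 1 ∧ r < inner ℝ v u := by
  rw [subspaceDelta, lt_sSup_iff_of_nonneg _ hr]
  · simp only [← lt_distToSubspace_iff hr]
    constructor
    · rintro ⟨_, ⟨v, hv, hv1, rfl⟩, h⟩
      exact ⟨v, hv, hv1, h⟩
    · rintro ⟨v, hv, hv1, h⟩
      exact ⟨_, ⟨v, hv, hv1, rfl⟩, h⟩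
  · refine ⟨1, ?_⟩
    rintro _ ⟨v, -, hv1, rfl⟩
    exact (distToSubspace_le_norm v B).trans_eq hv1

theorem subspaceDelta_nonneg (A B : Submodule ℝ 𝔼) : 0 ≤ subspaceDelta A B := by
  refine Real.sSup_nonneg ?_
  rintro _ ⟨v, -, -, rfl⟩
  exact distToSubspace_nonneg v B

theorem norm_mul_subspaceDelta (hA : Module.finrank ℝ A = 1) {w : 𝔼} (hw : w ∈ A) :
    ‖w‖ * subspaceDelta A B = distToSubspace w B := by
  rcases eq_or_ne w 0 with rfl | h0
  · simp [distToSubspace_eq_norm_starProjection]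
  have hpos : 0 < ‖w‖ := norm_pos_iff.2 h0
  have hset : {r : ℝ | ∃ v ∈ A, ‖v‖ = 1 ∧ r = distToSubspace v B} =
      {‖w‖⁻¹ * distToSubspace w B} := by
    refine Set.eq_singleton_iff_unique_mem.2 ⟨⟨‖w‖⁻¹ • w, A.smul_mem _ hw,
      norm_smul_inv_norm h0, ?_⟩, ?_⟩
    · rw [distToSubspace_smul, abs_of_pos (inv_pos.2 hpos)]
    · rintro _ ⟨v, hv, hv1, rfl⟩
      obtain ⟨c, hc⟩ := (finrank_eq_one_iff_of_nonzero' (⟨w, hw⟩ : A) (by simpa using h0)).1 hA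
        ⟨v, hv⟩
      obtain rfl : c • w = v := congrArg Subtype.val hc
      rw [norm_smul, Real.norm_eq_abs] at hv1
      rw [distToSubspace_smul, eq_inv_of_mul_eq_one_left hv1]
  rw [subspaceDelta, hset, csSup_singleton, mul_inv_cancel_left₀ hpos.ne']

end Angles

section CurveSelection

variable {n d : ℕ} {L : FirstOrder.Language} [L.Structure ℝ]

local notation "𝔼" => EuclideanSpace ℝ (Fin n)

theorem IsOMinimalExpansion.exists_definable_curve (hL : IsOMinimalExpansion L) {F : Type}
    [RealCoordinates F] {P : 𝔼 → F → Prop} (hP : DefinablePred L fun q : 𝔼 × F => P q.1 q.2)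
    {x₀ : 𝔼} (hfreq : ∃ᶠ y in 𝓝[≠] x₀, ∃ x, P y x) :
    ∃ (y : ℝ → 𝔼) (x : ℝ → F), DefinableMap L y ∧ DefinableMap L x ∧
      ∀ᶠ t in 𝓝[>] 0, P (y t) (x t) ∧ ‖y t - x₀‖ = t := by
  have hQ : DefinablePred L fun q : ℝ × (𝔼 × F) => P q.2.1 q.2.2 ∧ ‖q.2.1 - x₀‖ = q.1 :=
    (hP.comp (.snd .id)).and (by fun_prop (disch := assumption))
  obtain ⟨c, hc, hPc⟩ := hL.exists_definable_choice
    (P := fun t (q : 𝔼 × F) => P q.1 q.2 ∧ ‖q.1 - x₀‖ = t) hQ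
  refine ⟨fun t => (c t).1, fun t => (c t).2, hc.fst, hc.snd, ?_⟩
  have hnorm : Tendsto (fun y => ‖y - x₀‖) (𝓝[≠] x₀) (𝓝[>] 0) := by
    refine tendsto_nhdsWithin_iff.2 ⟨?_, ?_⟩
    · exact (tendsto_norm_sub_self x₀).mono_left nhdsWithin_le_nhds
    · filter_upwards [self_mem_nhdsWithin] with y hy
      exact norm_pos_iff.2 (sub_ne_zero.2 hy)
  refine ((hL.decidesDefinable_nhdsGT 0).eventually_of_frequently (.exists hQ)
    (hnorm.frequently (hfreq.mono ?_))).mono hPc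
  rintro y ⟨x, hx⟩
  exact ⟨(y, x), hx, rfl⟩

/-- `x` is a nearest point on `X` to the point `y` of `Y`, and the quotient in Kuo's ratio test at
`x₀` exceeds `ε` there. -/
def ViolatesRatioTest (X Y : Set 𝔼) (x₀ : 𝔼) (ε : ℝ) (y x : 𝔼) : Prop :=
  y ∈ Y ∧ IsNearestPoint X y x ∧
    ε * ‖y - x‖ / ‖y - x₀‖ < subspaceDelta (tangentSpaceAt X x) (tangentSpaceAt Y y)

theorem definablePred_violatesRatioTest (hL : IsOMinimalExpansion L) {X Y : Set 𝔼} {k : ℕ}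
    (hX : IsC2Submanifold k X) (hY : IsC2Submanifold d Y) (hXdef : IsDefinableSet L X)
    (hYdef : IsDefinableSet L Y) (x₀ : 𝔼) {ε : ℝ} (hε : 0 ≤ ε) :
    DefinablePred L fun q : 𝔼 × 𝔼 => ViolatesRatioTest X Y x₀ ε q.1 q.2 := by
  have hT := hX.definablePred_mem_tangentSpaceAt hL hXdef
  have hN := hY.definablePred_mem_orthogonal hL hYdef
  have hnear := definablePred_isNearestPoint hL hXdef
  refine (?_ : DefinablePred L fun q : 𝔼 × 𝔼 => IsNearestPoint X q.1 q.2 ∧ ∃ v u : 𝔼,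
    (q.2 ∈ X ∧ v ∈ tangentSpaceAt X q.2) ∧ (q.1 ∈ Y ∧ u ∈ (tangentSpaceAt Y q.1)ᗮ) ∧
      ‖v‖ = 1 ∧ ‖u‖ = 1 ∧ ε * ‖q.1 - q.2‖ / ‖q.1 - x₀‖ < inner ℝ v u).congr fun q => ?_
  · refine hnear.and (.exists (.exists ?_))
    refine (hT.comp (f := fun p : ((𝔼 × 𝔼) × 𝔼) × 𝔼 => (p.1.1.2, p.1.2)) (by fun_prop)).and
      ((hN.comp (f := fun p : ((𝔼 × 𝔼) × 𝔼) × 𝔼 => (p.1.1.1, p.2)) (by fun_prop)).and ?_)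
    fun_prop (disch := assumption)
  · rw [ViolatesRatioTest, lt_subspaceDelta_iff (by positivity)]
    constructor
    · rintro ⟨hy, hx, v, hv, hv1, u, hu, hu1, h⟩
      exact ⟨hx, v, u, ⟨hx.1, hv⟩, ⟨hy, hu⟩, hv1, hu1, h⟩
    · rintro ⟨hx, v, u, ⟨-, hv⟩, ⟨hy, hu⟩, hv1, hu1, h⟩
      exact ⟨hy, hx, v, hv, hv1, u, hu, hu1, h⟩

end CurveSelection

section Asymptotics

open Asymptotics

variable {n : ℕ} {L : FirstOrder.Language} [L.Structure ℝ]

local notation "𝔼" => EuclideanSpace ℝ (Fin n)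

theorem deriv_eq_deriv_norm_smul_add {E : Type*} [NormedAddCommGroup E] [InnerProductSpace ℝ E]
    {z : ℝ → E} {t : ℝ} (hz : DifferentiableAt ℝ z t) (hne : z t ≠ 0) :
    deriv z t = deriv (fun s => ‖z s‖) t • ‖z t‖⁻¹ • z t +
      ‖z t‖ • deriv (fun s => ‖z s‖⁻¹ • z s) t := by
  have hρ : DifferentiableAt ℝ (fun s => ‖z s‖) t := hz.norm ℝ hne
  have hU : DifferentiableAt ℝ (fun s => ‖z s‖⁻¹ • z s) t :=
    (hρ.inv (norm_ne_zero_iff.2 hne)).smul hz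
  have hz_eq : z = fun s => ‖z s‖ • ‖z s‖⁻¹ • z s := by
    funext s
    rcases eq_or_ne (z s) 0 with h | h
    · simp [h]
    · rw [smul_inv_smul₀ (norm_ne_zero_iff.2 h)]
  rw [add_comm, ← (hρ.hasDerivAt.fun_smul hU.hasDerivAt).deriv, ← hz_eq]

theorem norm_inv_norm_smul_le_one {E : Type*} [NormedAddCommGroup E] [NormedSpace ℝ E] (v : E) :
    ‖‖v‖⁻¹ • v‖ ≤ 1 := by
  rw [norm_smul, norm_inv, norm_norm]
  exact inv_mul_le_one

theorem one_le_norm_deriv_of_norm_sub_eq {E : Type*} [NormedAddCommGroup E]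
    [InnerProductSpace ℝ E] {y : ℝ → E} {x₀ : E} {t : ℝ} (ht : 0 < t)
    (hy : ∀ᶠ s in 𝓝 t, ‖y s - x₀‖ = s) (hd : DifferentiableAt ℝ y t) : 1 ≤ ‖deriv y t‖ := by
  have hsq : 2 * inner ℝ (y t - x₀) (deriv y t) = 2 * t := by
    refine (hd.hasDerivAt.sub_const x₀).norm_sq.unique
      (HasDerivAt.congr_of_eventuallyEq (f := fun s => s ^ 2) ?_ ?_)
    · simpa using hasDerivAt_pow 2 t
    · filter_upwards [hy] with s hs
      rw [hs]
  have hle : t * 1 ≤ t * ‖deriv y t‖ := by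
    have := real_inner_le_norm (y t - x₀) (deriv y t)
    rw [hy.self_of_nhds] at this
    linarith
  exact le_of_mul_le_mul_left hle ht

theorem IsOMinimalExpansion.eventually_smul_deriv_eq (hL : IsOMinimalExpansion L) {z : ℝ → 𝔼}
    (hz : DefinableMap L z) (hne : ∀ᶠ t in 𝓝[>] 0, z t ≠ 0) :
    ∀ᶠ t in 𝓝[>] 0, t • deriv z t = (t * deriv (fun s => ‖z s‖) t) • ‖z t‖⁻¹ • z t +
      ‖z t‖ • t • deriv (fun s => ‖z s‖⁻¹ • z s) t := by
  filter_upwards [hne, hL.eventually_differentiableAt_euclidean hz 0] with t hne hz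
  rw [deriv_eq_deriv_norm_smul_add hz hne, smul_add, smul_smul, smul_comm ‖z t‖]

namespace IsPolynomiallyBounded

variable (hpb : IsPolynomiallyBounded L) (hL : IsOMinimalExpansion L)
  {z : ℝ → EuclideanSpace ℝ (Fin n)} (hz : DefinableMap L z)
  (h0 : Tendsto z (𝓝[>] 0) (𝓝 0)) (hne : ∀ᶠ t in 𝓝[>] 0, z t ≠ 0)
include hpb hL hz

theorem isBigO_mul_deriv_norm (h0 : Tendsto z (𝓝[>] 0) (𝓝 0)) :
    (fun t => t * deriv (fun s => ‖z s‖) t) =O[𝓝[>] 0] z :=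
  (hpb.isBigO_mul_deriv hL (hz.norm hL) (by simpa using h0.norm)).of_norm_right

theorem isLittleO_norm_smul_deriv_direction :
    (fun t => ‖z t‖ • t • deriv (fun s => ‖z s‖⁻¹ • z s) t) =o[𝓝[>] 0] z := by
  have hU' := hpb.tendsto_smul_deriv hL (((hz.norm hL).inv hL).euclidean_smul hL hz)
    (.of_forall fun t => norm_inv_norm_smul_le_one (z t))
  have h := (isBigO_refl z (𝓝[>] 0)).norm_norm.smul_isLittleO ((isLittleO_one_iff ℝ).2 hU')
  simp only [smul_eq_mul, mul_one] at h
  exact h.of_norm_right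

include h0 hne

theorem isBigO_smul_deriv : (fun t => t • deriv z t) =O[𝓝[>] 0] z := by
  have hU : (fun t => ‖z t‖⁻¹ • z t) =O[𝓝[>] 0] fun _ => (1 : ℝ) :=
    .of_bound 1 (.of_forall fun t => by simpa using norm_inv_norm_smul_le_one (z t))
  have hradial := (hpb.isBigO_mul_deriv_norm hL hz h0).norm_right.smul hU
  simp only [smul_eq_mul, mul_one] at hradial
  exact (hradial.of_norm_right.add (hpb.isLittleO_norm_smul_deriv_direction hL hz).isBigO).congr'
    ((hL.eventually_smul_deriv_eq hz hne).mono fun t ht => ht.symm) .rfl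

theorem isLittleO_distToSubspace_smul_deriv {B : ℝ → Submodule ℝ 𝔼}
    (hB : Tendsto (fun t => distToSubspace (‖z t‖⁻¹ • z t) (B t)) (𝓝[>] 0) (𝓝 0)) :
    (fun t => distToSubspace (t • deriv z t) (B t)) =o[𝓝[>] 0] z := by
  have hradial := (hpb.isBigO_mul_deriv_norm hL hz h0).norm_norm.mul_isLittleO
    ((isLittleO_one_iff ℝ).2 hB)
  simp only [mul_one] at hradial
  refine IsBigO.trans_isLittleO (.of_norm_eventuallyLE ?_) (hradial.of_norm_right.add
    (hpb.isLittleO_norm_smul_deriv_direction hL hz).norm_left)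
  filter_upwards [hL.eventually_smul_deriv_eq hz hne] with t ht
  rw [ht, Real.norm_of_nonneg (distToSubspace_nonneg _ _)]
  refine (distToSubspace_add_le _ _ _).trans ?_
  rw [distToSubspace_smul]
  exact add_le_add_right (distToSubspace_le_norm _ _) _

end IsPolynomiallyBounded

theorem isLittleO_mul_subspaceDelta (hpb : IsPolynomiallyBounded L) (hL : IsOMinimalExpansion L)
    {y x : ℝ → 𝔼} {x₀ : 𝔼} (hy : DefinableMap L y) (hx : DefinableMap L x)
    (hnorm : ∀ᶠ t in 𝓝[>] 0, ‖y t - x₀‖ = t) (hne : ∀ᶠ t in 𝓝[>] 0, y t - x t ≠ 0)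
    (hyx : (fun t => y t - x t) =o[𝓝[>] 0] fun t => t) {A B : ℝ → Submodule ℝ 𝔼}
    (hA : ∀ᶠ t in 𝓝[>] 0, Module.finrank ℝ (A t) = 1)
    (hxA : ∀ᶠ t in 𝓝[>] 0, deriv x t ∈ A t) (hyB : ∀ᶠ t in 𝓝[>] 0, deriv y t ∈ B t)
    (hB : Tendsto (fun t => distToSubspace (‖y t - x t‖⁻¹ • (y t - x t)) (B t)) (𝓝[>] 0) (𝓝 0)) :
    (fun t => t * subspaceDelta (A t) (B t)) =o[𝓝[>] 0] fun t => y t - x t := by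
  have hz : DefinableMap L fun t => y t - x t := hy.euclidean_sub hL hx
  have h0 : Tendsto (fun t => y t - x t) (𝓝[>] 0) (𝓝 0) :=
    hyx.trans_tendsto (tendsto_id.mono_left nhdsWithin_le_nhds)
  have hz' : ∀ᶠ t in 𝓝[>] 0, ‖deriv (fun s => y s - x s) t‖ ≤ 1 / 2 := by
    have hsmul := (hpb.isBigO_smul_deriv hL hz h0 hne).trans_isLittleO hyx
    filter_upwards [hsmul.bound (half_pos one_pos), self_mem_nhdsWithin] with t ht (ht0 : 0 < t)
    rw [norm_smul, mul_comm] at ht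
    exact le_of_mul_le_mul_right ht (norm_pos_iff.2 ht0.ne')
  refine IsBigO.trans_isLittleO (.of_bound 2 ?_)
    (hpb.isLittleO_distToSubspace_smul_deriv hL hz h0 hne hB)
  filter_upwards [self_mem_nhdsWithin, eventually_nhdsGT_eventually_nhds hnorm, hA, hxA, hyB, hz',
    hL.eventually_differentiableAt_euclidean hy 0, hL.eventually_differentiableAt_euclidean hx 0]
    with t (ht : 0 < t) hnorm hA hxA hyB hz' hyd hxd
  have hx' : 1 / 2 ≤ ‖deriv x t‖ := by
    rw [deriv_fun_sub hyd hxd] at hz'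
    linarith [one_le_norm_deriv_of_norm_sub_eq ht hnorm hyd,
      norm_sub_norm_le (deriv y t) (deriv x t)]
  have hxz : distToSubspace (deriv x t) (B t) =
      distToSubspace (deriv (fun s => y s - x s) t) (B t) :=
    distToSubspace_eq_of_add_mem (by rwa [deriv_fun_sub hyd hxd, add_sub_cancel])
  have hα := subspaceDelta_nonneg (A t) (B t)
  rw [Real.norm_of_nonneg (mul_nonneg ht.le hα), Real.norm_of_nonneg (distToSubspace_nonneg _ _)]
  calc t * subspaceDelta (A t) (B t)
      ≤ 2 * (t * (‖deriv x t‖ * subspaceDelta (A t) (B t))) := by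
        nlinarith [mul_nonneg ht.le (mul_nonneg (sub_nonneg.2 hx') hα)]
    _ = 2 * distToSubspace (t • deriv (fun s => y s - x s) t) (B t) := by
      rw [norm_mul_subspaceDelta hA hxA, hxz, distToSubspace_smul, abs_of_pos ht]

end Asymptotics

section RatioTest

open Asymptotics

variable {n d : ℕ} {L : FirstOrder.Language} [L.Structure ℝ]
  {X Y : Set (EuclideanSpace ℝ (Fin n))} {x₀ : EuclideanSpace ℝ (Fin n)}

local notation "𝔼" => EuclideanSpace ℝ (Fin n)

theorem exists_frequently_violatesRatioTest (hX : IsC2Submanifold 1 X) (h0 : x₀ ∈ X)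
    (hr : ¬KuoRatioTestAt Y X x₀) :
    ∃ ε > 0, ∃ᶠ y in 𝓝[≠] x₀, ∃ x, ViolatesRatioTest X Y x₀ ε y x := by
  rw [KuoRatioTestAt, Metric.nhds_basis_closedBall.tendsto_right_iff] at hr
  push Not at hr
  obtain ⟨ε, hε, hfreq⟩ := hr
  refine ⟨ε, hε, ?_⟩
  rw [frequently_nhdsWithin_iff] at hfreq ⊢
  refine (hfreq.and_eventually (hX.eventually_isNearestPoint_iff h0)).mono ?_
  rintro y ⟨⟨hlt, hy⟩, hnear⟩
  have hα : 0 ≤ tangentAngle Y X y := subspaceDelta_nonneg _ _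
  rw [mem_closedBall_zero_iff, not_le, Real.norm_of_nonneg (by positivity)] at hlt
  have hyx : 0 < ‖y - nearestPoint X y‖ := by
    by_contra h
    rw [le_antisymm (not_lt.1 h) (norm_nonneg _), div_zero] at hlt
    exact hlt.not_gt hε
  have hyx₀ : 0 < ‖y - x₀‖ := by
    by_contra h
    rw [le_antisymm (not_lt.1 h) (norm_nonneg _), zero_mul, zero_div] at hlt
    exact hlt.not_gt hε
  refine ⟨⟨nearestPoint X y, hy, (hnear _).2 rfl, ?_⟩, sub_ne_zero.1 (norm_pos_iff.1 hyx₀)⟩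
  rw [div_lt_iff₀' hyx₀]
  exact (lt_div_iff₀ hyx).1 hlt

theorem isLittleO_of_mul_norm_lt {E ι : Type*} [NormedAddCommGroup E] {l : Filter ι} {z : ι → E}
    {f α : ι → ℝ} {ε : ℝ} (hε : 0 < ε) (hα : Tendsto α l (𝓝 0))
    (hlt : ∀ᶠ t in l, ε * ‖z t‖ < f t * α t) : z =o[l] f := by
  refine IsBigO.trans_isLittleO (g := fun t => f t * α t) (.of_bound ε⁻¹ (hlt.mono fun t ht => ?_))
    (by simpa using (isBigO_refl f l).mul_isLittleO ((isLittleO_one_iff ℝ).2 hα))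
  rw [← div_eq_inv_mul, le_div_iff₀' hε]
  exact ht.le.trans (Real.le_norm_self _)

theorem IsOMinimalExpansion.eventually_deriv_mem_tangentSpaceAt (hL : IsOMinimalExpansion L)
    {M : Set 𝔼} {γ : ℝ → 𝔼} (hγ : DefinableMap L γ) (hM : ∀ᶠ t in 𝓝[>] 0, γ t ∈ M) :
    ∀ᶠ t in 𝓝[>] 0, deriv γ t ∈ tangentSpaceAt M (γ t) := by
  filter_upwards [eventually_nhdsGT_eventually_nhds hM,
    hL.eventually_differentiableAt_euclidean hγ 0] with t hM hd
  exact mem_tangentSpaceAt_of_hasDerivAt hM hd.hasDerivAt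

theorem frequently_not_violatesRatioTest (hL : IsOMinimalExpansion L)
    (hpb : IsPolynomiallyBounded L) (hX : IsC2Submanifold 1 X) (hXY : Disjoint X Y)
    (h0 : x₀ ∈ X) (hb : WhitneyBAt Y X x₀) {y x : ℝ → 𝔼} (hy : DefinableMap L y)
    (hx : DefinableMap L x) {ε : ℝ} (hε : 0 < ε) (hnorm : ∀ᶠ t in 𝓝[>] 0, ‖y t - x₀‖ = t) :
    ∃ᶠ t in 𝓝[>] 0, ¬ViolatesRatioTest X Y x₀ ε (y t) (x t) := by
  intro hviol
  simp only [not_not] at hviol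
  set α := fun t => subspaceDelta (tangentSpaceAt X (x t)) (tangentSpaceAt Y (y t))
  have hyY : Tendsto y (𝓝[>] 0) (𝓝[Y] x₀) := by
    refine tendsto_nhdsWithin_iff.2
      ⟨tendsto_iff_norm_sub_tendsto_zero.2 ?_, hviol.mono fun t h => h.1⟩
    exact (tendsto_id.mono_left nhdsWithin_le_nhds).congr' (hnorm.mono fun t ht => ht.symm)
  have hπ : ∀ᶠ t in 𝓝[>] 0, x t = nearestPoint X (y t) := by
    filter_upwards [hviol, (tendsto_nhds_of_tendsto_nhdsWithin hyY).eventually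
      (hX.eventually_isNearestPoint_iff h0)] with t ht hnear
    exact (hnear (x t)).1 ht.2.1
  have hα : Tendsto α (𝓝[>] 0) (𝓝 0) :=
    (hb.1.comp hyY).congr' (hπ.mono fun t ht => by simp [α, tangentAngle, ht])
  have hβ : Tendsto (fun t => distToSubspace (‖y t - x t‖⁻¹ • (y t - x t))
      (tangentSpaceAt Y (y t))) (𝓝[>] 0) (𝓝 0) :=
    (hb.2.comp hyY).congr' (hπ.mono fun t ht => by simp [secantAngle, ht])
  have hlt : ∀ᶠ t in 𝓝[>] 0, ε * ‖y t - x t‖ < t * α t := by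
    filter_upwards [hviol, hnorm, self_mem_nhdsWithin] with t ht hnorm (ht0 : 0 < t)
    simpa only [hnorm, div_lt_iff₀' ht0] using ht.2.2
  have hyx : (fun t => y t - x t) =o[𝓝[>] 0] fun t => t := isLittleO_of_mul_norm_lt hε hα hlt
  have hsmall := isLittleO_mul_subspaceDelta hpb hL hy hx hnorm
    (hviol.mono fun t ht => sub_ne_zero.2 (hXY.symm.ne_of_mem ht.1 ht.2.1.1)) hyx
    (hviol.mono fun t ht => hX.finrank_tangentSpaceAt ht.2.1.1)
    (hL.eventually_deriv_mem_tangentSpaceAt hx (hviol.mono fun t ht => ht.2.1.1))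
    (hL.eventually_deriv_mem_tangentSpaceAt hy (hviol.mono fun t ht => ht.1)) hβ
  obtain ⟨t, hle, hgt⟩ := ((hsmall.bound hε).and hlt).exists
  exact (hgt.trans_le ((Real.le_norm_self _).trans hle)).false

theorem proposition3p1_general (hL : IsOMinimalExpansion L) (hpb : IsPolynomiallyBounded L)
    (hX : IsC2Submanifold 1 X) (hY : IsC2Submanifold d Y) (hXdef : IsDefinableSet L X)
    (hYdef : IsDefinableSet L Y) (hXY : Disjoint X Y) (h0 : x₀ ∈ X) (hb : WhitneyBAt Y X x₀) :
    KuoRatioTestAt Y X x₀ := by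
  by_contra hr
  obtain ⟨ε, hε, hfreq⟩ := exists_frequently_violatesRatioTest hX h0 hr
  obtain ⟨y, x, hy, hx, hcurve⟩ := hL.exists_definable_curve
    (definablePred_violatesRatioTest hL hX hY hXdef hYdef x₀ hε.le) hfreq
  obtain ⟨hviol, hnorm⟩ := eventually_and.1 hcurve
  exact frequently_not_violatesRatioTest hL hpb hX hXY h0 hb hy hx hε hnorm
    (hviol.mono fun t => not_not_intro)

end RatioTest

theorem proposition3p1 (L : FirstOrder.Language) [L.Structure ℝ]
    (hL : IsOMinimalExpansion L) (hpb : IsPolynomiallyBounded L)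
    {n d : ℕ} (X Y : Set (EuclideanSpace ℝ (Fin n)))
    (hX : IsC2Submanifold 1 X) (hY : IsC2Submanifold d Y)
    (hXdef : IsDefinableSet L X) (hYdef : IsDefinableSet L Y)
    (hXY : Disjoint X Y) (h0 : (0 : EuclideanSpace ℝ (Fin n)) ∈ X ∩ closure Y)
    (hb : WhitneyBAt Y X 0) :
    KuoRatioTestAt Y X 0 :=
  proposition3p1_general hL hpb hX hY hXdef hYdef hXY h0.1 hb
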